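/- Let $\mathcal H$ be a separable quaternionic (right) Hilbert space, let $J$ be a bounded right linear operator on $\mathcal H$ that is anti-selfadjoint and unitary, and let $i\in\mathbb H$ be an imaginary unit ($\operatorname{Re} i=0$, $|i|=1$). Put $\mathcal H_+^{Ji}=\{x\in\mathcal H : Jx=xi\}$, a complex Hilbert space over $\mathbb C_i=\mathbb R+i\mathbb R$. For a compact right linear operator $T$ on $\mathcal H$ let $\lambda_1(T)\ge\lambda_2(T)\ge\dots\ge 0$ be its singular values, i.e. the eigenvalues of $|T|=(T^*T)^{1/2}$ in decreasing order, repeated according to multiplicity and followed by zeros if there are only finitely many. For $0<p<\infty$ let $S_p(J)$ be the set of compact $T$ with $TJ=JT$ and $\sum_n\lambda_n(T)^p<\infty$, and let $\|T\|_p=\big(\sum_n\lambda_n(T)^p\big)^{1/p}\in[0,\infty]$. Orthonormal sets $\{e_n\}$ may be finite or infinite. **Theorem.** Let $T$ be a compact right linear operator on $\mathcal H$ with $[T,J]=TJ-JT=0$. 1. Let $2\le p<\infty$. Then $T\in S_p(J)$ if and only if $\sum_n\|Te_n\|^p<\infty$ for all orthonormal sets $\{e_n\}$ in $\mathcal H_+^{Ji}$.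 Moreover, $$\|T\|_p=\sup\Big\{\Big[\sum_n\|Te_n\|^p\Big]^{1/p} : \{e_n\}\text{ orthonormal in }\mathcal H_+^{Ji}\Big\}.$$ 2. Let $1\le p<\infty$. Then $T\in S_p(J)$ if and only if $\sum_n|\langle e_n,Te_n\rangle|^p<\infty$ for all orthonormal sets $\{e_n\}$ in $\mathcal H_+^{Ji}$. If $T$ is also selfadjoint, then $$\|T\|_p=\sup\Big\{\Big[\sum_n|\langle e_n,Te_n\rangle|^p\Big]^{1/p} : \{e_n\}\text{ orthonormal in }\mathcal H_+^{Ji}\Big\}.$$ 3. Let $1\le p<\infty$. Then $T\in S_p(J)$ if and only if $\sum_n|\langle \sigma_n,Te_n\rangle|^p<\infty$ for all orthonormal sets $\{e_n\}$ and $\{\sigma_n\}$ in $\mathcal H_+^{Ji}$ (with the same index set). If $T$ is also positive, then $$\|T\|_p=\sup\Big\{\Big[\sum_n|\langle \sigma_n,Te_n\rangle|^p\Big]^{1/p} : \{e_n\},\{\sigma_n\}\text{ orthonormal in }\mathcal H_+^{Ji}\Big\}.$$ 4. Let $0<p\le 2$. Then for every orthonormal basis $\{e_n\}$ of the complex Hilbert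 space $\mathcal H_+^{Ji}$, $$\|T\|_p^p\le\sum_n\sum_k|\langle e_k,Te_n\rangle|^p$$ (both sides may be $+\infty$). -/

import Mathlib

open scoped Quaternion ENNReal

namespace QuatSchatten

/-- Right quaternionic inner product space: a right vector space over `ℍ` (that is, a module over
`ℍᵐᵒᵖ`, the vector `x a` being `MulOpposite.op a • x`) with an `ℍ`-valued scalar product that is
right-linear in its second argument and hermitian. The last axiom says that the norm is
`√⟨x, x⟩`; positivity and definiteness of the scalar product are contained in it, since `‖·‖`
is a norm. A quaternionic Hilbert space is such a space that is also complete. -/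
class QuaternionicInnerProductSpace (H : Type*) [NormedAddCommGroup H] extends
    Module ℍᵐᵒᵖ H, Inner ℍ H where
  inner_add_right : ∀ x y z : H, inner x (y + z) = inner x y + inner x z
  inner_smul_right : ∀ (x y : H) (a : ℍ), inner x (MulOpposite.op a • y) = inner x y * a
  star_inner : ∀ x y : H, star (inner x y) = inner y x
  inner_self_eq : ∀ x : H, inner x x = ((‖x‖ ^ 2 : ℝ) : ℍ)

section Adjoint

variable {H : Type*} [NormedAddCommGroup H] [QuaternionicInnerProductSpace H]

theorem qinner_add_left (x y z : H) : inner ℍ (x + y) z = inner ℍ x z + inner ℍ y z := by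
  rw [← QuaternionicInnerProductSpace.star_inner z, QuaternionicInnerProductSpace.inner_add_right,
    star_add, QuaternionicInnerProductSpace.star_inner, QuaternionicInnerProductSpace.star_inner]

theorem qinner_smul_left (x y : H) (a : ℍ) :
    inner ℍ (MulOpposite.op a • x) y = star a * inner ℍ x y := by
  rw [← QuaternionicInnerProductSpace.star_inner y, QuaternionicInnerProductSpace.inner_smul_right,
    star_mul, QuaternionicInnerProductSpace.star_inner]

theorem qext_inner {x y : H} (h : ∀ z, inner ℍ x z = inner ℍ y z) : x = y := by
  have h1 : ∀ z, inner ℍ (x - y) z = 0 := by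
    intro z
    have h2 := qinner_add_left (x - y) y z
    rw [sub_add_cancel, h z] at h2
    simpa using h2.symm
  have h3 := h1 (x - y)
  rw [QuaternionicInnerProductSpace.inner_self_eq] at h3
  have h4 : ‖x - y‖ ^ 2 = 0 := Quaternion.coe_injective (by rw [h3, Quaternion.coe_zero])
  exact sub_eq_zero.1 (norm_eq_zero.1 (by simpa using h4))

/-- Existence of the adjoint, through the real Hilbert space with scalar product `Re ⟨x, y⟩`. -/
theorem exists_adjoint [CompleteSpace H] (T : H →L[ℍᵐᵒᵖ] H) :
    ∃ S : H →L[ℍᵐᵒᵖ] H, ∀ x y : H, inner ℍ (S x) y = inner ℍ x (T y) := by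
  let : Module ℝ H := Module.compHom H (algebraMap ℝ ℍᵐᵒᵖ)
  have smul_def : ∀ (r : ℝ) (x : H), r • x = MulOpposite.op (r : ℍ) • x := fun r x => rfl
  let : NormedSpace ℝ H :=
    { norm_smul_le := by
        intro r x
        have h1 : (((‖r • x‖ ^ 2 : ℝ)) : ℍ) = (((‖r‖ * ‖x‖) ^ 2 : ℝ) : ℍ) := by
          rw [← QuaternionicInnerProductSpace.inner_self_eq, smul_def,
            QuaternionicInnerProductSpace.inner_smul_right, qinner_smul_left,
            QuaternionicInnerProductSpace.inner_self_eq]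
          rw [Quaternion.star_coe, ← Quaternion.coe_mul, ← Quaternion.coe_mul]
          congr 1
          rw [mul_pow, Real.norm_eq_abs, sq_abs]
          ring
        have h2 : ‖r • x‖ ^ 2 = (‖r‖ * ‖x‖) ^ 2 := Quaternion.coe_injective h1
        exact le_of_eq ((sq_eq_sq₀ (norm_nonneg _) (by positivity)).1 h2) }
  let : InnerProductSpace ℝ H :=
    { inner := fun x y => (inner ℍ x y).re
      norm_sq_eq_re_inner := by
        intro x
        exact (congrArg (fun q : ℍ => q.re)
          (QuaternionicInnerProductSpace.inner_self_eq x)).symm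
      conj_inner_symm := by
        intro x y
        rw [← QuaternionicInnerProductSpace.star_inner x y]
        simp
      add_left := by
        intro x y z
        simp [qinner_add_left]
      smul_left := by
        intro x y r
        simp [smul_def, qinner_smul_left] }
  have inner_def : ∀ x y : H, inner ℝ x y = (inner ℍ x y).re := fun x y => rfl
  let Tr : H →L[ℝ] H :=
    { toFun := T
      map_add' := T.map_add
      map_smul' := fun r x => T.map_smul _ x
      cont := T.continuous }
  let A : H →L[ℝ] H := ContinuousLinearMap.adjoint Tr
  have hA : ∀ x y : H, inner ℍ (A x) y = inner ℍ x (T y) := by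
    intro x y
    have h1 : ∀ a : ℍ, (inner ℍ (A x) y * a).re = (inner ℍ x (T y) * a).re := by
      intro a
      rw [← QuaternionicInnerProductSpace.inner_smul_right,
        ← QuaternionicInnerProductSpace.inner_smul_right, ← T.map_smul]
      exact ContinuousLinearMap.adjoint_inner_left Tr (MulOpposite.op a • y) x
    have h2 := h1 (star (inner ℍ (A x) y - inner ℍ x (T y)))
    rw [← sub_eq_zero, ← Quaternion.re_sub, ← sub_mul, ← Quaternion.normSq_def,
      Quaternion.normSq_eq_zero] at h2
    exact sub_eq_zero.1 h2
  refine ⟨{ toFun := A, map_add' := A.map_add, map_smul' := ?_, cont := A.continuous }, hA⟩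
  intro a x
  apply qext_inner
  intro z
  have h1 : inner ℍ (A (a • x)) z = inner ℍ (a • A x) z := by
    rw [hA, ← MulOpposite.op_unop a, qinner_smul_left, qinner_smul_left, hA]
  exact h1

/-- The adjoint `T*`: the operator with `⟨T* x, y⟩ = ⟨x, T y⟩` for all `x`, `y`. -/
noncomputable def adjoint [CompleteSpace H] (T : H →L[ℍᵐᵒᵖ] H) : H →L[ℍᵐᵒᵖ] H :=
  Classical.choose (exists_adjoint T)

theorem qadjoint_inner_left [CompleteSpace H] (T : H →L[ℍᵐᵒᵖ] H) (x y : H) :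
    inner ℍ (adjoint T x) y = inner ℍ x (T y) :=
  Classical.choose_spec (exists_adjoint T) x y

end Adjoint

section Definitions

variable {H : Type*} [NormedAddCommGroup H] [QuaternionicInnerProductSpace H]

/-- Orthonormal families with respect to the quaternionic scalar product. -/
def IsOrthonormal {ι : Type*} (e : ι → H) : Prop :=
  (∀ k, ‖e k‖ = 1) ∧ ∀ k l, k ≠ l → inner ℍ (e k) (e l) = 0

/-- `T` is positive: `⟨x, T x⟩` is a nonnegative real number for every `x`. -/
def IsPositive (T : H →L[ℍᵐᵒᵖ] H) : Prop :=
  ∀ x : H, ∃ r : ℝ, 0 ≤ r ∧ inner ℍ x (T x) = (r : ℍ)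

/-- `J` is anti-selfadjoint and unitary. -/
def IsAntiSelfAdjointUnitary [CompleteSpace H] (J : H →L[ℍᵐᵒᵖ] H) : Prop :=
  adjoint J = -J ∧ adjoint J * J = 1 ∧ J * adjoint J = 1

/-- The complex subspace `H₊^{Ji} = {x : J x = x i}`. -/
def HPlus (J : H →L[ℍᵐᵒᵖ] H) (i : ℍ) : Set H :=
  {x | J x = MulOpposite.op i • x}

/-- `e` is an orthonormal family (a finite or infinite one) of vectors of `H₊^{Ji}`. -/
def IsOrthonormalIn (J : H →L[ℍᵐᵒᵖ] H) (i : ℍ) {ι : Type*} (e : ι → H) : Prop :=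
  IsOrthonormal e ∧ ∀ k, e k ∈ HPlus J i

/-- `e` is an orthonormal basis of the complex Hilbert space `H₊^{Ji}`: an orthonormal family in
it such that only the zero vector of `H₊^{Ji}` is orthogonal to all its members. -/
def IsOrthonormalBasisOf (J : H →L[ℍᵐᵒᵖ] H) (i : ℍ) {ι : Type*} (e : ι → H) : Prop :=
  IsOrthonormalIn J i e ∧ ∀ x ∈ HPlus J i, (∀ k, inner ℍ (e k) x = 0) → x = 0

/-- The `n`-th singular value of `T` (`n = 0, 1, 2, …`): the `(n+1)`-st largest eigenvalue of
`|T| = (T* T)^{1/2}`, that is, the `(n+1)`-st largest square root of an eigenvalue of `T* T`,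
repeated according to multiplicity. It is the largest `s` for which there are `n + 1` orthonormal
eigenvectors of `T* T` with eigenvalues `μ_k ^ 2`, `μ_k ≥ s`, and it is `0` if there are no
`n + 1` orthonormal eigenvectors. -/
noncomputable def singularValue [CompleteSpace H] (T : H →L[ℍᵐᵒᵖ] H) (n : ℕ) : ℝ :=
  sSup {s : ℝ | 0 ≤ s ∧ ∃ (e : Fin (n + 1) → H) (μ : Fin (n + 1) → ℝ), IsOrthonormal e ∧
    ∀ k, s ≤ μ k ∧ adjoint T (T (e k)) = MulOpposite.op ((μ k ^ 2 : ℝ) : ℍ) • e k}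

/-- The `(J, p)`-Schatten class `S_p(J)`, for `0 < p < ∞`. -/
def schattenClass [CompleteSpace H] (J : H →L[ℍᵐᵒᵖ] H) (p : ℝ) : Set (H →L[ℍᵐᵒᵖ] H) :=
  {T | IsCompactOperator T ∧ T * J = J * T ∧ Summable fun n => singularValue T n ^ p}

/-- `‖T‖_p`, the `ℓ^p` (quasi-)norm of the sequence of singular values, for `0 < p < ∞`; it has
the value `∞` if the sequence is not in `ℓ^p`. -/
noncomputable def schattenNorm [CompleteSpace H] (p : ℝ) (T : H →L[ℍᵐᵒᵖ] H) : ℝ≥0∞ :=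
  (∑' n, ENNReal.ofReal (singularValue T n) ^ p) ^ (1 / p)

end Definitions

end QuatSchatten

open QuatSchatten

/-!
Diagonalizing `T* T` by an orthonormal set of vectors `gₖ` of `H₊` that is total in the whole space
gives `T = ∑ σₖ μₖ ⟨gₖ, ·⟩`, where the `μₖ` are the nonzero singular values and the `σₖ` also lie
in `H₊`. The upper bounds are Jensen's inequality for doubly substochastic weights: `‖T eₙ‖ ^ 2` is
the mean of the `μₖ ^ 2` with weights `‖⟨gₖ, eₙ⟩‖ ^ 2`, and `‖⟨fₙ, T eₙ⟩‖` is at most the mean of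
the `μₖ` with weights `‖⟨σₖ, fₙ⟩‖ ‖⟨gₖ, eₙ⟩‖`. They are attained at `e = g`, `f = σ`. For `p ≤ 2`
Jensen's inequality is reversed and the weights of a basis sum to `1` in each column.

If only the diagonal sums of `T` are known to be finite, split `T` into the selfadjoint operators
`T + T*` and `J (T - T*)`. The factor `J` replaces the imaginary unit, which does not act linearly:
on `H₊` it multiplies `⟨x, ·⟩` by a unit quaternion. The diagonal of each of the two operators is
bounded by that of `T`, and a selfadjoint operator attains its norm on its diagonal.
-/

namespace QuatSchatten

open Filter Topology MulOpposite

section CompactOperators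

theorem exists_eigenvector_mem {𝕜 E : Type*} [RCLike 𝕜] [NormedAddCommGroup E]
    [InnerProductSpace 𝕜 E] [CompleteSpace E] {A : E →L[𝕜] E} (hA : IsCompactOperator A)
    (hs : A.IsSymmetric) {M : Submodule 𝕜 E} (hM : IsClosed (M : Set E)) (hAM : ∀ x ∈ M, A x ∈ M)
    (hne : M ≠ ⊥) : ∃ x ∈ M, ‖x‖ = 1 ∧ ∃ c : 𝕜, A x = c • x := by
  have := hM.completeSpace_coe
  have := M.nontrivial_iff_ne_bot.2 hne
  obtain ⟨c, hc⟩ : ∃ c, Module.End.eigenspace (A.restrict hAM : Module.End 𝕜 M) c ≠ ⊥ := by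
    by_contra! h
    have hbot := ContinuousLinearMap.orthogonalComplement_iSup_eigenspaces_eq_bot
      (T := A.restrict hAM) (hA.restrict' hAM) (hs.restrict_invariant hAM)
    simp only [h, iSup_bot, Submodule.bot_orthogonal_eq_top] at hbot
    exact top_ne_bot hbot
  obtain ⟨y, hy, hy0⟩ := Submodule.exists_mem_ne_zero_of_ne_bot hc
  have hAy : A y = c • (y : E) := congrArg Subtype.val (Module.End.mem_eigenspace_iff.1 hy)
  refine ⟨(‖y‖⁻¹ : 𝕜) • (y : E), M.smul_mem _ y.2, ?_, c, ?_⟩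
  · exact norm_smul_inv_norm (x := (y : E)) (by simpa using hy0)
  · rw [map_smul, hAy, smul_comm]

theorem isCompactOperator_of_norm_sq_le {E F G : Type*} [SeminormedAddCommGroup E]
    [NormedSpace ℝ E] [NormedAddCommGroup F] [NormedSpace ℝ F] [CompleteSpace F]
    [NormedAddCommGroup G] [NormedSpace ℝ G] {R : E →ₗ[ℝ] G} (hR : IsCompactOperator R)
    {S : E →ₗ[ℝ] F} (h : ∀ w, ‖S w‖ ^ 2 ≤ ‖w‖ * ‖R w‖) : IsCompactOperator S := by
  rw [isCompactOperator_iff_isCompact_closure_image_closedBall S one_pos]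
  refine (Metric.totallyBounded_iff.2 fun ε hε => ?_).closure.isCompact_of_isClosed isClosed_closure
  have htb := (hR.isCompact_closure_image_closedBall 1).totallyBounded.subset subset_closure
  obtain ⟨t, ht, htf, hcov⟩ :=
    Metric.finite_approx_of_totallyBounded htb (ε ^ 2 / 2) (by positivity)
  obtain ⟨s, hs, hsf, rfl⟩ := Set.exists_subset_image_finite_and.1 ⟨t, ht, htf, rfl⟩
  refine ⟨S '' s, hsf.image S, ?_⟩
  rintro _ ⟨x, hx, rfl⟩
  obtain ⟨_, ⟨y, hy, rfl⟩, hxy⟩ := Set.mem_iUnion₂.1 (hcov ⟨x, hx, rfl⟩)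
  refine Set.mem_iUnion₂.2 ⟨S y, ⟨y, hy, rfl⟩, ?_⟩
  rw [Metric.mem_ball, dist_eq_norm, ← map_sub] at hxy ⊢
  have hle : ‖x - y‖ ≤ 2 := by
    have := norm_sub_le x y
    have := mem_closedBall_zero_iff.1 hx
    have := mem_closedBall_zero_iff.1 (hs hy)
    linarith
  refine lt_of_pow_lt_pow_left₀ 2 hε.le ((h _).trans_lt ?_)
  nlinarith [norm_nonneg (R (x - y))]

theorem isSeparable_range_of_isCompactOperator {E F : Type*} [SeminormedAddCommGroup E]
    [NormedSpace ℝ E] [NormedAddCommGroup F] [NormedSpace ℝ F] {T : E →ₗ[ℝ] F}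
    (hT : IsCompactOperator T) : TopologicalSpace.IsSeparable (Set.range T) := by
  rw [← Set.image_univ, ← Metric.iUnion_closedBall_nat (0 : E), Set.image_iUnion]
  exact .iUnion fun n =>
    (hT.isCompact_closure_image_closedBall n).isSeparable.mono subset_closure

end CompactOperators

section Inequalities

variable {ι κ : Type*}

theorem rpow_tsum_le_tsum_rpow (x : ι → ℝ≥0∞) {q : ℝ} (hq0 : 0 < q) (hq : q ≤ 1) :
    (∑' k, x k) ^ q ≤ ∑' k, x k ^ q :=
  le_of_tendsto' ((ENNReal.continuous_rpow_const.tendsto _).comp ENNReal.summable.hasSum) fun s =>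
    (Finset.le_sum_of_subadditive (fun y : ℝ≥0∞ => y ^ q) (ENNReal.zero_rpow_of_pos hq0).le
      (fun y z => ENNReal.rpow_add_le_add_rpow y z hq0.le hq) s x).trans (ENNReal.sum_le_tsum s)

theorem tsum_mul_le_one {a b : ι → ℝ≥0∞} (ha : ∑' k, a k ^ 2 ≤ 1) (hb : ∑' k, b k ^ 2 ≤ 1) :
    ∑' k, a k * b k ≤ 1 := by
  have hroot {f : ι → ℝ≥0∞} (hf : ∑' k, f k ^ 2 ≤ 1) (s : Finset ι) :
      (∑ k ∈ s, f k ^ (2 : ℝ)) ^ (1 / 2 : ℝ) ≤ 1 := by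
    simp_rw [ENNReal.rpow_two]
    exact ENNReal.rpow_le_one ((ENNReal.sum_le_tsum s).trans hf) (by norm_num)
  rw [ENNReal.tsum_eq_iSup_sum]
  exact iSup_le fun s => (ENNReal.inner_le_Lp_mul_Lq s a b .two_two).trans
    (mul_le_one' (hroot ha s) (hroot hb s))

theorem rpow_tsum_mul_le_tsum_mul_rpow {w : ι → ℝ≥0∞} (hw : ∑' k, w k ≤ 1) (x : ι → ℝ≥0∞)
    {q : ℝ} (hq : 1 ≤ q) : (∑' k, w k * x k) ^ q ≤ ∑' k, w k * x k ^ q := by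
  have hq0 : 0 < q := one_pos.trans_le hq
  rw [← ENNReal.le_rpow_inv_iff hq0, ENNReal.tsum_eq_iSup_sum]
  refine iSup_le fun s => ?_
  calc ∑ k ∈ s, w k * x k
      ≤ (∑ k ∈ s, w k) ^ (1 - q⁻¹) * (∑ k ∈ s, w k * x k ^ q) ^ q⁻¹ :=
        ENNReal.inner_le_weight_mul_Lp_of_nonneg s hq w x
    _ ≤ 1 * (∑' k, w k * x k ^ q) ^ q⁻¹ := by
        gcongr
        · exact ENNReal.rpow_le_one ((ENNReal.sum_le_tsum s).trans hw)
            (sub_nonneg.2 (inv_le_one_of_one_le₀ hq))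
        · exact ENNReal.sum_le_tsum s
    _ = (∑' k, w k * x k ^ q) ^ q⁻¹ := one_mul _

theorem tsum_mul_rpow_le_rpow_tsum_mul {w : ι → ℝ≥0∞} (hw : ∑' k, w k ≤ 1) (x : ι → ℝ≥0∞)
    {q : ℝ} (hq0 : 0 < q) (hq : q ≤ 1) : ∑' k, w k * x k ^ q ≤ (∑' k, w k * x k) ^ q := by
  rw [← ENNReal.rpow_inv_le_iff hq0]
  refine (rpow_tsum_mul_le_tsum_mul_rpow hw _ ((one_le_inv₀ hq0).2 hq)).trans_eq ?_
  simp_rw [ENNReal.rpow_rpow_inv hq0.ne']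

theorem tsum_rpow_tsum_mul_le {w : ι → κ → ℝ≥0∞} (hrow : ∀ n, ∑' k, w n k ≤ 1)
    (hcol : ∀ k, ∑' n, w n k ≤ 1) (x : κ → ℝ≥0∞) {q : ℝ} (hq : 1 ≤ q) :
    ∑' n, (∑' k, w n k * x k) ^ q ≤ ∑' k, x k ^ q :=
  calc ∑' n, (∑' k, w n k * x k) ^ q
      ≤ ∑' n, ∑' k, w n k * x k ^ q :=
        ENNReal.tsum_le_tsum fun n => rpow_tsum_mul_le_tsum_mul_rpow (hrow n) x hq
    _ = ∑' k, (∑' n, w n k) * x k ^ q := by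
        rw [ENNReal.tsum_comm]
        simp_rw [ENNReal.tsum_mul_right]
    _ ≤ ∑' k, x k ^ q := ENNReal.tsum_le_tsum fun k => mul_le_of_le_one_left' (hcol k)

theorem tsum_rpow_le_tsum_rpow_tsum_mul {w : ι → κ → ℝ≥0∞} (hrow : ∀ n, ∑' k, w n k ≤ 1)
    (hcol : ∀ k, ∑' n, w n k = 1) (x : κ → ℝ≥0∞) {q : ℝ} (hq0 : 0 < q) (hq : q ≤ 1) :
    ∑' k, x k ^ q ≤ ∑' n, (∑' k, w n k * x k) ^ q :=
  calc ∑' k, x k ^ q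
      = ∑' k, (∑' n, w n k) * x k ^ q := by simp_rw [hcol, one_mul]
    _ = ∑' n, ∑' k, w n k * x k ^ q := by
        rw [ENNReal.tsum_comm]
        simp_rw [ENNReal.tsum_mul_right]
    _ ≤ ∑' n, (∑' k, w n k * x k) ^ q :=
        ENNReal.tsum_le_tsum fun n => tsum_mul_rpow_le_rpow_tsum_mul (hrow n) x hq0 hq

theorem enorm_le_enorm_add_add_enorm_sub {E : Type*} [SeminormedAddCommGroup E] [NormedSpace ℝ E]
    (a b : E) : ‖a‖ₑ ≤ ‖a + b‖ₑ + ‖a - b‖ₑ := by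
  have h := norm_add_le (a + b) (a - b)
  rw [add_add_sub_cancel, ← two_smul ℝ, norm_smul, Real.norm_ofNat] at h
  simp_rw [← ofReal_norm]
  rw [← ENNReal.ofReal_add (norm_nonneg _) (norm_nonneg _)]
  exact ENNReal.ofReal_le_ofReal (by linarith [norm_nonneg a])

theorem sq_rpow_half (a : ℝ≥0∞) (p : ℝ) : (a ^ 2) ^ (p / 2) = a ^ p := by
  rw [← ENNReal.rpow_two, ← ENNReal.rpow_mul, mul_div_cancel₀ p two_ne_zero]

open MeasureTheory in
theorem tsum_ofReal_rpow_eq_of_encard_eq {f : ι → ℝ} {g : κ → ℝ} (hf : ∀ a, 0 ≤ f a)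
    (hg : ∀ b, 0 ≤ g b) (h : ∀ t, 0 ≤ t → {a | t < f a}.encard = {b | t < g b}.encard)
    {p : ℝ} (hp : 0 < p) : ∑' a, ENNReal.ofReal (f a) ^ p = ∑' b, ENNReal.ofReal (g b) ^ p := by
  let _ : MeasurableSpace ι := ⊤
  let _ : MeasurableSpace κ := ⊤
  simp_rw [ENNReal.ofReal_rpow_of_nonneg (hf _) hp.le, ENNReal.ofReal_rpow_of_nonneg (hg _) hp.le]
  rw [← lintegral_count, ← lintegral_count,
    lintegral_rpow_eq_lintegral_meas_lt_mul _ (Eventually.of_forall hf)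
      measurable_from_top.aemeasurable hp,
    lintegral_rpow_eq_lintegral_meas_lt_mul _ (Eventually.of_forall hg)
      measurable_from_top.aemeasurable hp]
  congr 1
  refine setLIntegral_congr_fun measurableSet_Ioi fun t ht => ?_
  rw [Measure.count_apply MeasurableSpace.measurableSet_top,
    Measure.count_apply MeasurableSpace.measurableSet_top, h t (le_of_lt ht)]

theorem exists_equiv_set_nat (α : Type*) [Countable α] : ∃ I : Set ℕ, Nonempty (I ≃ α) :=
  let ⟨f, hf⟩ := Countable.exists_injective_nat α
  ⟨Set.range f, ⟨(Equiv.ofInjective f hf).symm⟩⟩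

theorem exists_maximal_pairwise {α : Type*} (V : Set α) (r : α → α → Prop) :
    ∃ S, Maximal (fun S : Set α => S ⊆ V ∧ S.Pairwise r) S :=
  zorn_subset {S | S ⊆ V ∧ S.Pairwise r} fun c hcV hc =>
    ⟨⋃₀ c, ⟨Set.sUnion_subset fun _ hs => (hcV hs).1,
      (Set.pairwise_sUnion hc.directedOn).2 fun _ hs => (hcV hs).2⟩,
      fun _ hs => Set.subset_sUnion_of_mem hs⟩

end Inequalities

variable {H : Type*} [NormedAddCommGroup H] [QuaternionicInnerProductSpace H]

theorem qinner_add_right (x y z : H) : inner ℍ x (y + z) = inner ℍ x y + inner ℍ x z :=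
  QuaternionicInnerProductSpace.inner_add_right x y z

theorem qinner_smul_right (x y : H) (a : ℍ) : inner ℍ x (op a • y) = inner ℍ x y * a :=
  QuaternionicInnerProductSpace.inner_smul_right x y a

theorem star_qinner (x y : H) : star (inner ℍ x y) = inner ℍ y x :=
  QuaternionicInnerProductSpace.star_inner x y

theorem qinner_self (x : H) : inner ℍ x x = ((‖x‖ ^ 2 : ℝ) : ℍ) :=
  QuaternionicInnerProductSpace.inner_self_eq x

theorem norm_qinner_comm (x y : H) : ‖inner ℍ x y‖ = ‖inner ℍ y x‖ := by
  rw [← star_qinner, Quaternion.norm_star]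

theorem enorm_qinner_comm (x y : H) : ‖inner ℍ x y‖ₑ = ‖inner ℍ y x‖ₑ := by
  rw [← ofReal_norm, ← ofReal_norm, norm_qinner_comm]

theorem qinner_eq_zero_comm {x y : H} : inner ℍ x y = 0 ↔ inner ℍ y x = 0 := by
  rw [← star_qinner, star_eq_zero]

/-- The scalar product `⟨x, ·⟩` as an additive map. -/
def qinnerHom (x : H) : H →+ ℍ :=
  AddMonoidHom.mk' (fun y => inner ℍ x y) (qinner_add_right x)

theorem qinner_zero_right (x : H) : inner ℍ x (0 : H) = 0 := map_zero (qinnerHom x)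

theorem qinner_sub_right (x y z : H) : inner ℍ x (y - z) = inner ℍ x y - inner ℍ x z :=
  map_sub (qinnerHom x) y z

theorem qinner_neg_right (x y : H) : inner ℍ x (-y) = -inner ℍ x y := map_neg (qinnerHom x) y

theorem qinner_sub_left (x y z : H) : inner ℍ (x - y) z = inner ℍ x z - inner ℍ y z := by
  rw [← star_qinner, qinner_sub_right, star_sub, star_qinner, star_qinner]

theorem star_mul_self_eq_norm_sq (a : ℍ) : star a * a = ((‖a‖ ^ 2 : ℝ) : ℍ) := by
  rw [Quaternion.star_mul_self, Quaternion.normSq_eq_norm_mul_self, sq]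

theorem norm_op_smul (a : ℍ) (x : H) : ‖op a • x‖ = ‖a‖ * ‖x‖ := by
  have h : ((‖op a • x‖ ^ 2 : ℝ) : ℍ) = (((‖a‖ * ‖x‖) ^ 2 : ℝ) : ℍ) := by
    rw [← qinner_self, qinner_smul_right, qinner_smul_left, qinner_self, mul_assoc,
      Quaternion.coe_commutes, ← mul_assoc, star_mul_self_eq_norm_sq, mul_pow, Quaternion.coe_mul]
  exact (sq_eq_sq₀ (norm_nonneg _) (by positivity)).1 (Quaternion.coe_injective h)

instance : NormSMulClass ℍᵐᵒᵖ H where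
  norm_smul a x := norm_op_smul a.unop x

/-- The real vector space underlying a right quaternionic one; `r • x` is by definition
`op (r : ℍ) • x`. -/
noncomputable local instance instModuleReal : Module ℝ H :=
  Module.compHom H (algebraMap ℝ ℍᵐᵒᵖ)

theorem real_smul_def (r : ℝ) (x : H) : r • x = op (r : ℍ) • x := rfl

theorem apply_real_smul (T : H →L[ℍᵐᵒᵖ] H) (r : ℝ) (x : H) : T (r • x) = r • T x :=
  map_smul T (op (r : ℍ)) x

local instance : IsScalarTower ℝ ℍᵐᵒᵖ H := .of_algebraMap_smul fun _ _ => rfl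

noncomputable local instance : NormedSpace ℝ H where
  norm_smul_le r x := by rw [real_smul_def, norm_op_smul, Quaternion.norm_coe]

/-- The real Hilbert space underlying a quaternionic one, with scalar product `Re ⟨x, y⟩`. -/
noncomputable local instance instInnerProductSpaceReal : InnerProductSpace ℝ H where
  inner x y := (inner ℍ x y).re
  norm_sq_eq_re_inner x := (congrArg (fun a : ℍ => a.re) (qinner_self x)).symm
  conj_inner_symm x y := by simp [← star_qinner x y]
  add_left x y z := by simp [qinner_add_left]
  smul_left x y r := by simp [real_smul_def, qinner_smul_left]

theorem real_inner_eq_re_qinner (x y : H) : inner ℝ x y = (inner ℍ x y).re := rfl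

theorem qinner_real_smul_right (x y : H) (r : ℝ) : inner ℍ x (r • y) = r * inner ℍ x y := by
  rw [real_smul_def, qinner_smul_right, Quaternion.coe_commutes]

theorem qinner_real_smul_left (x y : H) (r : ℝ) : inner ℍ (r • x) y = r * inner ℍ x y := by
  rw [real_smul_def, qinner_smul_left, Quaternion.star_coe]

theorem norm_qinner_le (x y : H) : ‖inner ℍ x y‖ ≤ ‖x‖ * ‖y‖ := by
  obtain h | h := (norm_nonneg (inner ℍ x y)).eq_or_lt
  · rw [← h]
    positivity
  have hre : inner ℝ x (op (star (inner ℍ x y)) • y) = ‖inner ℍ x y‖ * ‖inner ℍ x y‖ := by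
    rw [real_inner_eq_re_qinner, qinner_smul_right, Quaternion.self_mul_star, Quaternion.re_coe,
      Quaternion.normSq_eq_norm_mul_self]
  have hle := real_inner_le_norm x (op (star (inner ℍ x y)) • y)
  rw [hre, norm_op_smul, Quaternion.norm_star] at hle
  nlinarith

theorem continuous_qinner_right (x : H) : Continuous fun y : H => inner ℍ x y :=
  AddMonoidHomClass.continuous_of_bound (qinnerHom x) ‖x‖ (norm_qinner_le x)

theorem hasSum_qinner_right {ι : Type*} {f : ι → H} {y : H} (h : HasSum f y) (x : H) :
    HasSum (fun k => inner ℍ x (f k)) (inner ℍ x y) :=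
  h.map (qinnerHom x) (continuous_qinner_right x)

section Orthonormal

variable {ι : Type*} {e : ι → H}

/-- A family is total if only the zero vector is orthogonal to all its members. -/
def IsTotal (e : ι → H) : Prop := ∀ x : H, (∀ k, inner ℍ (e k) x = 0) → x = 0

/-- The isometric embedding `a ↦ u a` of `ℍ` onto the quaternionic line of a unit vector `u`. -/
noncomputable def quaternionicLine {u : H} (hu : ‖u‖ = 1) : ℍ →ₗᵢ[ℝ] H where
  toFun a := op a • u
  map_add' a b := by rw [op_add, add_smul]
  map_smul' r a := by
    rw [RingHom.id_apply, real_smul_def, smul_smul, ← op_mul, ← Quaternion.coe_commutes,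
      Quaternion.coe_mul_eq_smul]
  norm_map' a := by simp [norm_op_smul, hu]

theorem IsOrthonormal.comp {κ : Type*} (he : IsOrthonormal e) {f : κ → ι}
    (hf : Function.Injective f) : IsOrthonormal (e ∘ f) :=
  ⟨fun _ => he.1 _, fun _ _ h => he.2 _ _ (hf.ne h)⟩

theorem IsOrthonormal.enorm_eq_one (he : IsOrthonormal e) (k : ι) : ‖e k‖ₑ = 1 := by
  rw [← ofReal_norm, he.1, ENNReal.ofReal_one]

theorem IsOrthonormal.qinner_self_eq_one (he : IsOrthonormal e) (k : ι) :
    inner ℍ (e k) (e k) = 1 := by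
  rw [qinner_self, he.1, one_pow, Quaternion.coe_one]

theorem IsOrthonormal.orthogonalFamily (he : IsOrthonormal e) :
    OrthogonalFamily ℝ (fun _ => ℍ) fun k => quaternionicLine (he.1 k) := fun k l hkl a b => by
  change (inner ℍ (op a • e k) (op b • e l)).re = 0
  rw [qinner_smul_left, qinner_smul_right, he.2 k l hkl, zero_mul, mul_zero, Quaternion.re_zero]

theorem IsOrthonormal.norm_sum_sq (he : IsOrthonormal e) (F : Finset ι) (a : ι → ℍ) :
    ‖∑ k ∈ F, op (a k) • e k‖ ^ 2 = ∑ k ∈ F, ‖a k‖ ^ 2 :=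
  he.orthogonalFamily.norm_sum a F

theorem IsOrthonormal.summable_smul_iff [CompleteSpace H] (he : IsOrthonormal e) (a : ι → ℍ) :
    (Summable fun k => op (a k) • e k) ↔ Summable fun k => ‖a k‖ ^ 2 :=
  he.orthogonalFamily.summable_iff_norm_sq_summable a

theorem IsOrthonormal.hasSum_norm_sq (he : IsOrthonormal e) {a : ι → ℍ} {y : H}
    (h : HasSum (fun k => op (a k) • e k) y) : HasSum (fun k => ‖a k‖ ^ 2) (‖y‖ ^ 2) :=
  (h.norm.pow 2).congr fun F => he.norm_sum_sq F a

theorem IsOrthonormal.qinner_eq_of_hasSum (he : IsOrthonormal e) {a : ι → ℍ} {y : H}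
    (h : HasSum (fun k => op (a k) • e k) y) (k : ι) : inner ℍ (e k) y = a k := by
  have hsingle := hasSum_single (f := fun l => inner ℍ (e k) (op (a l) • e l)) k
    fun l hl => by rw [qinner_smul_right, he.2 k l hl.symm, zero_mul]
  rw [(hasSum_qinner_right h (e k)).unique hsingle, qinner_smul_right, he.qinner_self_eq_one,
    one_mul]

theorem IsOrthonormal.sum_norm_sq_le (he : IsOrthonormal e) (F : Finset ι) (x : H) :
    ∑ k ∈ F, ‖inner ℍ (e k) x‖ ^ 2 ≤ ‖x‖ ^ 2 := by
  set P := ∑ k ∈ F, op (inner ℍ (e k) x) • e k with hP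
  have hxP : inner ℝ x P = ‖P‖ ^ 2 := by
    rw [he.norm_sum_sq, hP, inner_sum]
    refine Finset.sum_congr rfl fun k _ => ?_
    rw [real_inner_eq_re_qinner, qinner_smul_right, ← star_qinner, star_mul_self_eq_norm_sq,
      Quaternion.re_coe]
  have hsub := norm_sub_sq_real x P
  rw [← he.norm_sum_sq]
  nlinarith [sq_nonneg ‖x - P‖]

theorem IsOrthonormal.tsum_enorm_sq_le (he : IsOrthonormal e) (x : H) :
    ∑' k, ‖inner ℍ (e k) x‖ₑ ^ 2 ≤ ‖x‖ₑ ^ 2 := by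
  rw [ENNReal.tsum_eq_iSup_sum]
  refine iSup_le fun F => ?_
  simp_rw [← ofReal_norm, ← ENNReal.ofReal_pow (norm_nonneg _)]
  rw [← ENNReal.ofReal_sum_of_nonneg fun _ _ => by positivity]
  exact ENNReal.ofReal_le_ofReal (he.sum_norm_sq_le F x)

theorem IsOrthonormal.tsum_enorm_sq_le_one (he : IsOrthonormal e) {κ : Type*} {f : κ → H}
    (hf : IsOrthonormal f) (n : κ) : ∑' k, ‖inner ℍ (e k) (f n)‖ₑ ^ 2 ≤ 1 :=
  (he.tsum_enorm_sq_le (f n)).trans_eq (by rw [hf.enorm_eq_one, one_pow])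

theorem IsOrthonormal.tsum_enorm_sq_of_hasSum (he : IsOrthonormal e) {a : ι → ℍ} {y : H}
    (h : HasSum (fun k => op (a k) • e k) y) : ∑' k, ‖a k‖ₑ ^ 2 = ‖y‖ₑ ^ 2 := by
  have hsq := he.hasSum_norm_sq h
  simp_rw [← ofReal_norm, ← ENNReal.ofReal_pow (norm_nonneg _)]
  rw [← ENNReal.ofReal_tsum_of_nonneg (fun _ => by positivity) hsq.summable, hsq.tsum_eq]

theorem IsOrthonormal.hasSum_expansion [CompleteSpace H] (he : IsOrthonormal e) (ht : IsTotal e)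
    (x : H) : HasSum (fun k => op (inner ℍ (e k) x) • e k) x := by
  obtain ⟨y, hy⟩ := (he.summable_smul_iff _).2
    (summable_of_sum_le (fun _ => by positivity) fun F => he.sum_norm_sq_le F x)
  have hxy : x - y = 0 := ht _ fun k => by
    rw [qinner_sub_right, he.qinner_eq_of_hasSum hy, sub_self]
  rwa [← sub_eq_zero.1 hxy] at hy

theorem IsOrthonormal.tsum_enorm_sq [CompleteSpace H] (he : IsOrthonormal e) (ht : IsTotal e)
    (x : H) : ∑' k, ‖inner ℍ (e k) x‖ₑ ^ 2 = ‖x‖ₑ ^ 2 :=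
  he.tsum_enorm_sq_of_hasSum (he.hasSum_expansion ht x)

theorem IsOrthonormal.enorm_rpow_le_tsum [CompleteSpace H] (he : IsOrthonormal e) (ht : IsTotal e)
    (x : H) {p : ℝ} (hp0 : 0 < p) (hp : p ≤ 2) :
    ‖x‖ₑ ^ p ≤ ∑' k, ‖inner ℍ (e k) x‖ₑ ^ p := by
  simp_rw [← sq_rpow_half _ p, ← he.tsum_enorm_sq ht x]
  exact rpow_tsum_le_tsum_rpow _ (half_pos hp0) (by linarith)

theorem IsOrthonormal.norm_sub_sq_eq_two (he : IsOrthonormal e) {k l : ι} (hkl : k ≠ l) :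
    ‖e k - e l‖ ^ 2 = 2 := by
  rw [norm_sub_sq_real, real_inner_eq_re_qinner, he.2 k l hkl, he.1, he.1, Quaternion.re_zero]
  norm_num

theorem IsOrthonormal.countable_of_isSeparable (he : IsOrthonormal e)
    (hs : TopologicalSpace.IsSeparable (Set.range e)) : Countable ι := by
  have := hs.separableSpace
  let u : ι → Set.range e := fun k => ⟨e k, k, rfl⟩
  refine Pairwise.countable_of_isOpen_disjoint (s := fun k => Metric.ball (u k) (1 / 2))
    (fun k l hkl => Metric.ball_disjoint_ball ?_) (fun _ => Metric.isOpen_ball)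
    fun k => ⟨u k, Metric.mem_ball_self (by norm_num)⟩
  rw [Subtype.dist_eq, dist_eq_norm]
  nlinarith [he.norm_sub_sq_eq_two hkl, norm_nonneg (e k - e l)]

end Orthonormal

section Operators

theorem isSeparable_range {T : H →L[ℍᵐᵒᵖ] H} (hT : IsCompactOperator T) :
    TopologicalSpace.IsSeparable (Set.range T) :=
  isSeparable_range_of_isCompactOperator (T := (T.restrictScalars ℝ : H →ₗ[ℝ] H)) hT

/-- The orthogonal complement of a set, as a real subspace. -/
def qorthogonal (S : Set H) : Submodule ℝ H where
  carrier := {x | ∀ y ∈ S, inner ℍ y x = 0}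
  zero_mem' y _ := qinner_zero_right y
  add_mem' hx hz y hy := by rw [qinner_add_right, hx y hy, hz y hy, add_zero]
  smul_mem' r x hx y hy := by rw [real_smul_def, qinner_smul_right, hx y hy, zero_mul]

theorem isClosed_qorthogonal (S : Set H) : IsClosed (qorthogonal S : Set H) := by
  have h : (qorthogonal S : Set H) = ⋂ y ∈ S, {x | inner ℍ y x = 0} := by
    ext x
    simp only [Set.mem_iInter]
    rfl
  rw [h]
  exact isClosed_biInter fun y _ => isClosed_eq (continuous_qinner_right y) continuous_const

variable [CompleteSpace H]

theorem qadjoint_inner_right (T : H →L[ℍᵐᵒᵖ] H) (x y : H) :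
    inner ℍ x (adjoint T y) = inner ℍ (T x) y := by
  rw [← star_qinner, qadjoint_inner_left, star_qinner]

theorem adjoint_eq_of_forall {S T : H →L[ℍᵐᵒᵖ] H}
    (h : ∀ x y, inner ℍ (S x) y = inner ℍ x (T y)) : adjoint T = S :=
  ContinuousLinearMap.ext fun x => qext_inner fun y => by rw [qadjoint_inner_left, h]

theorem adjoint_adjoint (T : H →L[ℍᵐᵒᵖ] H) : adjoint (adjoint T) = T :=
  adjoint_eq_of_forall fun x y => (qadjoint_inner_right T x y).symm

theorem adjoint_add (S T : H →L[ℍᵐᵒᵖ] H) : adjoint (S + T) = adjoint S + adjoint T :=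
  adjoint_eq_of_forall fun x y => by
    simp only [add_apply, qinner_add_left, qinner_add_right, qadjoint_inner_left]

theorem adjoint_sub (S T : H →L[ℍᵐᵒᵖ] H) : adjoint (S - T) = adjoint S - adjoint T :=
  adjoint_eq_of_forall fun x y => by
    simp only [sub_apply, qinner_sub_left, qinner_sub_right, qadjoint_inner_left]

theorem adjoint_mul (S T : H →L[ℍᵐᵒᵖ] H) : adjoint (S * T) = adjoint T * adjoint S :=
  adjoint_eq_of_forall fun x y => by
    simp only [mul_apply_eq_comp, qadjoint_inner_left]

theorem adjoint_adjoint_mul_self (T : H →L[ℍᵐᵒᵖ] H) :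
    adjoint (adjoint T * T) = adjoint T * T := by
  rw [adjoint_mul, adjoint_adjoint]

theorem isSymmetric_restrictScalars {A : H →L[ℍᵐᵒᵖ] H} (hA : adjoint A = A) :
    (A.restrictScalars ℝ).IsSymmetric := fun x y =>
  congrArg (fun a : ℍ => a.re) ((hA ▸ qadjoint_inner_left A x y :))

theorem isCompactOperator_adjoint {T : H →L[ℍᵐᵒᵖ] H} (hT : IsCompactOperator T) :
    IsCompactOperator (adjoint T) := by
  refine isCompactOperator_of_norm_sq_le
    (S := ((adjoint T).restrictScalars ℝ : H →ₗ[ℝ] H))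
    (R := ((T * adjoint T).restrictScalars ℝ : H →ₗ[ℝ] H)) (hT.comp_clm (adjoint T)) fun w => ?_
  have h := norm_qinner_le w (T (adjoint T w))
  rwa [← qadjoint_inner_left, qinner_self, Quaternion.norm_coe, Real.norm_of_nonneg (sq_nonneg _)]
    at h

theorem apply_mem_qorthogonal {A : H →L[ℍᵐᵒᵖ] H} (hA : adjoint A = A) {S : Set H}
    (hS : ∀ y ∈ S, ∃ r : ℝ, A y = r • y) : ∀ x ∈ qorthogonal S, A x ∈ qorthogonal S := by
  intro x hx y hy
  obtain ⟨r, hr⟩ := hS y hy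
  rw [← hA, qadjoint_inner_right, hr, real_smul_def, qinner_smul_left, hx y hy, mul_zero]

theorem exists_orthonormal_eigenvectors {A : H →L[ℍᵐᵒᵖ] H} (hA : IsCompactOperator A)
    (hs : adjoint A = A) {V : Submodule ℝ H} (hV : IsClosed (V : Set H)) (hAV : ∀ x ∈ V, A x ∈ V) :
    ∃ S : Set H, S ⊆ V ∧ IsOrthonormal (Subtype.val : S → H) ∧
      (∀ y ∈ S, ∃ r : ℝ, A y = r • y) ∧ V ⊓ qorthogonal S = ⊥ := by
  obtain ⟨S, ⟨hSV, hSpair⟩, hSmax⟩ := exists_maximal_pairwise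
    {y : H | y ∈ V ∧ ‖y‖ = 1 ∧ ∃ r : ℝ, A y = r • y} fun x y => inner ℍ x y = 0
  refine ⟨S, fun y hy => (hSV hy).1, ⟨fun y => (hSV y.2).2.1, fun x y hxy =>
    hSpair x.2 y.2 (Subtype.coe_ne_coe.2 hxy)⟩, fun y hy => (hSV hy).2.2, ?_⟩
  by_contra hne
  obtain ⟨y, ⟨hyV, hyS⟩, hy1, hyr⟩ := exists_eigenvector_mem (A := A.restrictScalars ℝ) hA
    (isSymmetric_restrictScalars hs) (M := V ⊓ qorthogonal S)
    (hV.inter (isClosed_qorthogonal S))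
    (fun x hx => ⟨hAV x hx.1, apply_mem_qorthogonal hs (fun y hy => (hSV hy).2.2) x hx.2⟩) hne
  have hinsert := hSmax ⟨Set.insert_subset ⟨hyV, hy1, hyr⟩ hSV, hSpair.insert fun z hz _ =>
    ⟨qinner_eq_zero_comm.1 (hyS z hz), hyS z hz⟩⟩ (Set.subset_insert y S)
  have hyy : inner ℍ y y = 0 := hyS y (hinsert (Set.mem_insert y S))
  rw [qinner_self, hy1, one_pow, Quaternion.coe_one] at hyy
  exact one_ne_zero hyy

end Operators

section HPlus

theorem mul_self_eq_neg_one {i : ℍ} (hi : i.re = 0) (hn : ‖i‖ = 1) : i * i = -1 := by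
  rw [← sq, Quaternion.sq_eq_neg_normSq.2 hi, Quaternion.normSq_eq_norm_mul_self, hn, one_mul,
    Quaternion.coe_one]

theorem mul_eq_neg_mul_of_orthogonal {v w : ℍ} (hv : v.re = 0) (hw : w.re = 0)
    (h : w.imI * v.imI + w.imJ * v.imJ + w.imK * v.imK = 0) : w * v = -(v * w) := by
  ext <;> simp [hv, hw] <;> linarith

theorem exists_ne_zero_mul_eq_neg_mul {v : ℍ} (hv : v.re = 0) :
    ∃ w : ℍ, w ≠ 0 ∧ w * v = -(v * w) := by
  by_cases h : v.imI = 0 ∧ v.imJ = 0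
  · refine ⟨⟨0, 1, 0, 0⟩, fun h0 => one_ne_zero (congrArg QuaternionAlgebra.imI h0),
      mul_eq_neg_mul_of_orthogonal hv rfl ?_⟩
    simp only [h.1, h.2]
    ring
  · refine ⟨⟨0, -v.imJ, v.imI, 0⟩, fun h0 => h ⟨congrArg QuaternionAlgebra.imJ h0,
      neg_eq_zero.1 (congrArg QuaternionAlgebra.imI h0)⟩, mul_eq_neg_mul_of_orthogonal hv rfl ?_⟩
    ring

theorem apply_mem_HPlus {J A : H →L[ℍᵐᵒᵖ] H} {i : ℍ} (hAJ : Commute A J) {x : H}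
    (hx : x ∈ HPlus J i) : A x ∈ HPlus J i :=
  calc J (A x) = A (J x) := (congrArg (fun S : H →L[ℍᵐᵒᵖ] H => S x) hAJ.eq).symm
    _ = op i • A x := by rw [show J x = op i • x from hx, map_smul]

theorem IsOrthonormalIn.comp {J : H →L[ℍᵐᵒᵖ] H} {i : ℍ} {ι κ : Type*} {e : ι → H}
    (he : IsOrthonormalIn J i e) {f : κ → ι} (hf : Function.Injective f) :
    IsOrthonormalIn J i (e ∘ f) :=
  ⟨he.1.comp hf, fun _ => he.2 _⟩

/-- `H₊^{Ji}` as a real subspace. -/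
def hPlusSubmodule (J : H →L[ℍᵐᵒᵖ] H) (i : ℍ) : Submodule ℝ H where
  carrier := HPlus J i
  zero_mem' := by change J 0 = op i • 0; rw [map_zero, smul_zero]
  add_mem' {x y} hx hy := by
    change J (x + y) = op i • (x + y)
    rw [map_add, smul_add, show J x = op i • x from hx, show J y = op i • y from hy]
  smul_mem' r x hx := by
    change J (r • x) = op i • r • x
    rw [real_smul_def, map_smul, show J x = op i • x from hx, smul_smul, smul_smul, ← op_mul,
      ← op_mul, Quaternion.coe_commutes]

theorem isClosed_hPlusSubmodule (J : H →L[ℍᵐᵒᵖ] H) (i : ℍ) :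
    IsClosed (hPlusSubmodule J i : Set H) :=
  isClosed_eq J.continuous (continuous_const_smul (op i))

variable [CompleteSpace H] {J : H →L[ℍᵐᵒᵖ] H} {i : ℍ}

theorem apply_apply_eq_neg (hJ : IsAntiSelfAdjointUnitary J) (x : H) : J (J x) = -x :=
  neg_eq_iff_eq_neg.1 (congrArg (fun S : H →L[ℍᵐᵒᵖ] H => S x) (hJ.1 ▸ hJ.2.1))

theorem qinner_apply_right (hJ : IsAntiSelfAdjointUnitary J) (x y : H) :
    inner ℍ x (J y) = -inner ℍ (J x) y := by
  rw [← qadjoint_inner_left, hJ.1, neg_apply, ← star_qinner, qinner_neg_right, star_neg,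
    star_qinner]

theorem qinner_apply_right_of_mem_HPlus (hJ : IsAntiSelfAdjointUnitary J) {x : H}
    (hx : x ∈ HPlus J i) (y : H) : inner ℍ x (J y) = -(star i * inner ℍ x y) := by
  rw [qinner_apply_right hJ, show J x = op i • x from hx, qinner_smul_left]

theorem commute_adjoint (hJ : IsAntiSelfAdjointUnitary J) {T : H →L[ℍᵐᵒᵖ] H}
    (h : Commute T J) : Commute (adjoint T) J := by
  have hadj : -J * adjoint T = adjoint T * -J := by
    rw [← hJ.1, ← adjoint_mul, ← adjoint_mul, h.eq]
  ext x
  have hx : -J (adjoint T x) = adjoint T (-J x) :=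
    congrArg (fun S : H →L[ℍᵐᵒᵖ] H => S x) hadj
  rw [map_neg, neg_inj] at hx
  exact hx.symm

theorem isTotal_of_HPlus (hJ : IsAntiSelfAdjointUnitary J) (hi : i.re = 0) (hn : ‖i‖ = 1)
    {ι : Type*} {e : ι → H} (he : IsOrthonormalBasisOf J i e) : IsTotal e := by
  -- If `x` is orthogonal to `e`, then `J x = -x i`; multiplying by a quaternion `w` that
  -- anticommutes with `i` moves `x` into `H₊`.
  intro x hx
  have hplus : J x + op i • x ∈ HPlus J i := by
    change J (J x + op i • x) = op i • (J x + op i • x)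
    rw [map_add, map_smul, apply_apply_eq_neg hJ, smul_add, smul_smul, ← op_mul,
      mul_self_eq_neg_one hi hn, op_neg, op_one, neg_smul, one_smul, add_comm]
  have hJx : J x + op i • x = 0 := he.2 _ hplus fun k => by
    rw [qinner_add_right, qinner_smul_right, qinner_apply_right_of_mem_HPlus hJ (he.1.2 k), hx]
    simp only [mul_zero, neg_zero, zero_mul, add_zero]
  obtain ⟨w, hw0, hw⟩ := exists_ne_zero_mul_eq_neg_mul hi
  have hwx : op w • x ∈ HPlus J i := by
    change J (op w • x) = op i • op w • x
    rw [map_smul, eq_neg_of_add_eq_zero_left hJx, smul_neg, smul_smul, smul_smul, ← op_mul,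
      ← op_mul, ← neg_smul, ← op_neg, hw]
  have hzero := he.2 _ hwx fun k => by rw [qinner_smul_right, hx, zero_mul]
  exact (smul_eq_zero.1 hzero).resolve_left ((op_ne_zero_iff w).2 hw0)

theorem exists_eigenbasis (hJ : IsAntiSelfAdjointUnitary J) (hi : i.re = 0) (hn : ‖i‖ = 1)
    {A : H →L[ℍᵐᵒᵖ] H} (hA : IsCompactOperator A) (hs : adjoint A = A) (hAJ : Commute A J) :
    ∃ S : Set H, IsOrthonormalIn J i (Subtype.val : S → H) ∧ IsTotal (Subtype.val : S → H) ∧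
      ∀ y ∈ S, ∃ r : ℝ, A y = r • y := by
  obtain ⟨S, hSV, hS, hSA, hmax⟩ := exists_orthonormal_eigenvectors hA hs
    (isClosed_hPlusSubmodule J i) fun x hx => apply_mem_HPlus hAJ hx
  have hbasis : IsOrthonormalBasisOf J i (Subtype.val : S → H) :=
    ⟨⟨hS, fun y => hSV y.2⟩, fun x hx hxS =>
      (Submodule.eq_bot_iff _).1 hmax x ⟨hx, fun y hy => hxS ⟨y, hy⟩⟩⟩
  exact ⟨S, hbasis.1, isTotal_of_HPlus hJ hi hn hbasis, hSA⟩

end HPlus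

/-- `T = ∑ₖ σₖ μₖ ⟨gₖ, ·⟩`, with orthonormal families `g` and `σ` and real numbers `μₖ > 0`. -/
structure IsSchmidtDecomposition (T : H →L[ℍᵐᵒᵖ] H) {ι : Type*} (g σ : ι → H) (μ : ι → ℝ) :
    Prop where
  orthonormal_right : IsOrthonormal g
  orthonormal_left : IsOrthonormal σ
  pos : ∀ k, 0 < μ k
  hasSum : ∀ x, HasSum (fun k => op ((μ k : ℍ) * inner ℍ (g k) x) • σ k) (T x)

theorem isOrthonormal_normalize {ι : Type*} {v : ι → H} (hv0 : ∀ k, v k ≠ 0)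
    (hv : ∀ k l, k ≠ l → inner ℍ (v k) (v l) = 0) : IsOrthonormal fun k => ‖v k‖⁻¹ • v k :=
  ⟨fun k => norm_smul_inv_norm (𝕜 := ℝ) (hv0 k), fun k l hkl => by
    rw [qinner_real_smul_left, qinner_real_smul_right, hv k l hkl, mul_zero, mul_zero]⟩

theorem exists_isSchmidtDecomposition [CompleteSpace H] {κ : Type*} {g : κ → H}
    (hg : IsOrthonormal g) (ht : IsTotal g) {T : H →L[ℍᵐᵒᵖ] H} (hT : IsCompactOperator T)
    (hTg : ∀ k l, k ≠ l → inner ℍ (T (g k)) (T (g l)) = 0) :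
    ∃ (I : Set ℕ) (f : I → κ), Function.Injective f ∧ IsSchmidtDecomposition T (fun n => g (f n))
      (fun n => ‖T (g (f n))‖⁻¹ • T (g (f n))) (fun n => ‖T (g (f n))‖) := by
  have hσ : IsOrthonormal fun k : {k | T (g k) ≠ 0} => ‖T (g k)‖⁻¹ • T (g k) :=
    isOrthonormal_normalize (fun k => k.2) fun k l hkl => hTg k l (Subtype.coe_ne_coe.2 hkl)
  have hrange : Set.range (fun k : {k | T (g k) ≠ 0} => ‖T (g k)‖⁻¹ • T (g k)) ⊆ Set.range T := by
    rintro _ ⟨k, rfl⟩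
    exact ⟨_, apply_real_smul T ‖T (g k)‖⁻¹ (g k)⟩
  -- Compactness of `T` leaves countably many nonzero `T gₖ`, even if `H` is not separable.
  have := hσ.countable_of_isSeparable ((isSeparable_range hT).mono hrange)
  obtain ⟨I, ⟨f⟩⟩ := exists_equiv_set_nat {k | T (g k) ≠ 0}
  have hf : Function.Injective fun n => (f n : κ) := Subtype.val_injective.comp f.injective
  refine ⟨I, fun n => f n, hf, hg.comp hf, hσ.comp f.injective,
    fun n => norm_pos_iff.2 (f n).2, fun x => ?_⟩
  have hTx : HasSum (fun k => op (inner ℍ (g k) x) • T (g k)) (T x) := by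
    simpa only [map_smul] using T.hasSum (hg.hasSum_expansion ht x)
  have hsupp : ∀ k ∉ Set.range fun n => (f n : κ), op (inner ℍ (g k) x) • T (g k) = 0 := by
    intro k hk
    rw [not_ne_iff.1 fun h => hk ⟨f.symm ⟨k, h⟩, by simp⟩, smul_zero]
  refine ((hf.hasSum_iff hsupp).2 hTx).congr_fun fun n => ?_
  have hn : ‖T (g (f n))‖ ≠ 0 := norm_ne_zero_iff.2 (f n).2
  rw [Function.comp_apply, real_smul_def, smul_smul, ← op_mul, ← mul_assoc, ← Quaternion.coe_mul,
    inv_mul_cancel₀ hn, Quaternion.coe_one, one_mul]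

namespace IsSchmidtDecomposition

variable {ι : Type*} {T : H →L[ℍᵐᵒᵖ] H} {g σ : ι → H} {μ : ι → ℝ}

theorem qinner_apply (h : IsSchmidtDecomposition T g σ μ) (k : ι) (x : H) :
    inner ℍ (σ k) (T x) = (μ k : ℍ) * inner ℍ (g k) x :=
  h.orthonormal_left.qinner_eq_of_hasSum (h.hasSum x) k

theorem apply_right (h : IsSchmidtDecomposition T g σ μ) (k : ι) : T (g k) = μ k • σ k := by
  have hsingle := hasSum_single (f := fun l => op ((μ l : ℍ) * inner ℍ (g l) (g k)) • σ l) k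
    fun l hl => by rw [h.orthonormal_right.2 l k hl, mul_zero, op_zero, zero_smul]
  rw [(h.hasSum (g k)).unique hsingle, h.orthonormal_right.qinner_self_eq_one, mul_one,
    real_smul_def]

theorem enorm_apply_right (h : IsSchmidtDecomposition T g σ μ) (k : ι) :
    ‖T (g k)‖ₑ = ENNReal.ofReal (μ k) := by
  rw [h.apply_right, enorm_smul, h.orthonormal_left.enorm_eq_one, mul_one,
    Real.enorm_of_nonneg (h.pos k).le]

theorem enorm_mul_qinner (h : IsSchmidtDecomposition T g σ μ) (k : ι) (x : H) :
    ‖(μ k : ℍ) * inner ℍ (g k) x‖ₑ = ENNReal.ofReal (μ k) * ‖inner ℍ (g k) x‖ₑ := by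
  rw [enorm_mul, ← ofReal_norm (μ k : ℍ), Quaternion.norm_coe, Real.norm_of_nonneg (h.pos k).le]

theorem enorm_apply_sq (h : IsSchmidtDecomposition T g σ μ) (x : H) :
    ‖T x‖ₑ ^ 2 = ∑' k, ‖inner ℍ (g k) x‖ₑ ^ 2 * ENNReal.ofReal (μ k) ^ 2 := by
  simp_rw [← h.orthonormal_left.tsum_enorm_sq_of_hasSum (h.hasSum x), h.enorm_mul_qinner, mul_pow,
    mul_comm]

theorem enorm_qinner_apply_le (h : IsSchmidtDecomposition T g σ μ) (x y : H) :
    ‖inner ℍ y (T x)‖ₑ ≤ ∑' k, ‖inner ℍ (σ k) y‖ₑ * ‖inner ℍ (g k) x‖ₑ * ENNReal.ofReal (μ k) := by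
  rw [← (hasSum_qinner_right (h.hasSum x) y).tsum_eq]
  refine enorm_tsum_le_tsum_enorm.trans_eq (tsum_congr fun k => ?_)
  rw [qinner_smul_right, enorm_mul, h.enorm_mul_qinner, enorm_qinner_comm]
  ring

variable [CompleteSpace H]

theorem adjoint_apply_left (h : IsSchmidtDecomposition T g σ μ) (k : ι) :
    adjoint T (σ k) = μ k • g k :=
  qext_inner fun x => by rw [qadjoint_inner_left, h.qinner_apply, qinner_real_smul_left]

theorem adjoint_apply_apply_right (h : IsSchmidtDecomposition T g σ μ) (k : ι) :
    adjoint T (T (g k)) = op ((μ k ^ 2 : ℝ) : ℍ) • g k := by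
  rw [h.apply_right, apply_real_smul, h.adjoint_apply_left, smul_smul, ← sq, real_smul_def]

theorem qinner_eq_zero_or_eq (h : IsSchmidtDecomposition T g σ μ) {x : H} {ν : ℝ}
    (hν : 0 ≤ ν) (hx : adjoint T (T x) = op ((ν ^ 2 : ℝ) : ℍ) • x) (k : ι) :
    inner ℍ (g k) x = 0 ∨ μ k = ν := by
  have hcomm : inner ℍ (g k) (adjoint T (T x)) = inner ℍ (adjoint T (T (g k))) x := by
    rw [qadjoint_inner_right, qadjoint_inner_left]
  rw [hx, h.adjoint_apply_apply_right, qinner_smul_right, qinner_smul_left, Quaternion.star_coe,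
    ← Quaternion.coe_commutes, ← sub_eq_zero, ← sub_mul, ← Quaternion.coe_sub] at hcomm
  refine (mul_eq_zero.1 hcomm).symm.imp_right fun h0 => ?_
  have hsq : ν ^ 2 - μ k ^ 2 = 0 := Quaternion.coe_injective (by rw [h0, Quaternion.coe_zero])
  exact (sq_eq_sq₀ (h.pos k).le hν).1 (sub_eq_zero.1 hsq).symm

theorem hasSum_of_eigenvector (h : IsSchmidtDecomposition T g σ μ) {x : H} {ν : ℝ}
    (hν : 0 < ν) (hx : adjoint T (T x) = op ((ν ^ 2 : ℝ) : ℍ) • x) :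
    HasSum (fun k => op (inner ℍ (g k) x) • g k) x := by
  have hsum := ((adjoint T).hasSum (h.hasSum x)).const_smul ((ν ^ 2)⁻¹)
  rw [hx, ← real_smul_def, inv_smul_smul₀ (by positivity)] at hsum
  refine hsum.congr_fun fun k => ?_
  obtain h0 | rfl := h.qinner_eq_zero_or_eq hν.le hx k
  · simp [h0]
  · rw [op_mul, mul_smul, map_smul, ← real_smul_def, apply_real_smul, h.adjoint_apply_left,
      smul_smul, ← sq, smul_comm, inv_smul_smul₀ (by positivity)]

end IsSchmidtDecomposition

/-- There are `m` orthonormal eigenvectors of `T* T` with eigenvalues `μₖ ^ 2`, `μₖ > t`. -/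
def HasEigenvectorsAbove [CompleteSpace H] (T : H →L[ℍᵐᵒᵖ] H) (t : ℝ) (m : ℕ) : Prop :=
  ∃ (e : Fin m → H) (μ : Fin m → ℝ), IsOrthonormal e ∧
    ∀ k, t < μ k ∧ adjoint T (T (e k)) = op ((μ k ^ 2 : ℝ) : ℍ) • e k

section SingularValues

variable [CompleteSpace H] {T : H →L[ℍᵐᵒᵖ] H}

theorem HasEigenvectorsAbove.mono {t : ℝ} {m n : ℕ} (hmn : m ≤ n)
    (h : HasEigenvectorsAbove T t n) : HasEigenvectorsAbove T t m :=
  let ⟨e, μ, he, hμ⟩ := h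
  ⟨e ∘ Fin.castLE hmn, μ ∘ Fin.castLE hmn, he.comp (Fin.castLE_injective hmn), fun _ => hμ _⟩

theorem norm_apply_eq_of_eigenvector {x : H} {ν : ℝ} (hν : 0 ≤ ν)
    (hx : adjoint T (T x) = op ((ν ^ 2 : ℝ) : ℍ) • x) : ‖T x‖ = ν * ‖x‖ := by
  have hsq : ((‖T x‖ ^ 2 : ℝ) : ℍ) = ((ν * ‖x‖) ^ 2 : ℝ) := by
    rw [← qinner_self, ← qadjoint_inner_right, hx, qinner_smul_right, qinner_self,
      ← Quaternion.coe_mul, mul_pow, mul_comm]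
  exact (sq_eq_sq₀ (norm_nonneg _) (by positivity)).1 (Quaternion.coe_injective hsq)

theorem le_opNorm_of_eigenvector {x : H} (hx1 : ‖x‖ = 1) {ν : ℝ} (hν : 0 ≤ ν)
    (hx : adjoint T (T x) = op ((ν ^ 2 : ℝ) : ℍ) • x) : ν ≤ ‖T.restrictScalars ℝ‖ := by
  have h := (T.restrictScalars ℝ).le_opNorm x
  rwa [ContinuousLinearMap.coe_restrictScalars', norm_apply_eq_of_eigenvector hν hx, hx1, mul_one,
    mul_one] at h

theorem singularValue_nonneg (T : H →L[ℍᵐᵒᵖ] H) (n : ℕ) : 0 ≤ singularValue T n :=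
  Real.sSup_nonneg fun _ h => h.1

theorem lt_singularValue_iff {t : ℝ} (ht : 0 ≤ t) (n : ℕ) :
    t < singularValue T n ↔ HasEigenvectorsAbove T t (n + 1) := by
  constructor
  · intro h
    have hne := Set.nonempty_iff_ne_empty.2 fun h0 =>
      h.not_ge ((congrArg sSup h0).trans Real.sSup_empty |>.trans_le ht)
    obtain ⟨s, ⟨-, e, μ, he, hμ⟩, hs⟩ := exists_lt_of_lt_csSup hne h
    exact ⟨e, μ, he, fun k => ⟨hs.trans_le (hμ k).1, (hμ k).2⟩⟩
  · rintro ⟨e, μ, he, hμ⟩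
    obtain ⟨k, hk⟩ := Finite.exists_min μ
    refine (hμ k).1.trans_le (le_csSup ⟨‖T.restrictScalars ℝ‖, ?_⟩
      ⟨ht.trans (hμ k).1.le, e, μ, he, fun l => ⟨hk l, (hμ l).2⟩⟩)
    rintro s ⟨hs, e, μ, he, hμ⟩
    exact (hμ 0).1.trans (le_opNorm_of_eigenvector (he.1 0) (hs.trans (hμ 0).1) (hμ 0).2)

theorem natCast_le_encard_lt_singularValue_iff {t : ℝ} (ht : 0 ≤ t) (m : ℕ) :
    (m : ℕ∞) ≤ {n | t < singularValue T n}.encard ↔ HasEigenvectorsAbove T t m := by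
  simp only [lt_singularValue_iff ht]
  have hencard (n : ℕ) : (Set.Iio n).encard = n := by
    rw [Set.encard_eq_coe_toFinset_card, Set.toFinset_Iio, Nat.card_Iio]
  refine ⟨fun h => ?_, fun h => ?_⟩
  · obtain _ | m := m
    · exact ⟨Fin.elim0, Fin.elim0, ⟨fun k => k.elim0, fun k => k.elim0⟩, fun k => k.elim0⟩
    · by_contra hm
      have hsub : {n | HasEigenvectorsAbove T t (n + 1)} ⊆ Set.Iio m := fun n hn =>
        not_le.1 fun hmn => hm (hn.mono (Nat.succ_le_succ hmn))
      have hle := h.trans ((Set.encard_le_encard hsub).trans_eq (hencard m))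
      exact Nat.not_succ_le_self m (Nat.cast_le.1 hle)
  · have hsub : Set.Iio m ⊆ {n | HasEigenvectorsAbove T t (n + 1)} := fun n hn =>
      h.mono (Nat.succ_le_of_lt hn)
    exact (hencard m).ge.trans (Set.encard_le_encard hsub)

namespace IsSchmidtDecomposition

variable {ι : Type*} {g σ : ι → H} {μ : ι → ℝ}

theorem hasEigenvectorsAbove (h : IsSchmidtDecomposition T g σ μ) {t : ℝ} {m : ℕ}
    (hm : (m : ℕ∞) ≤ {k | t < μ k}.encard) : HasEigenvectorsAbove T t m := by
  obtain ⟨s, hs, hsm⟩ := Set.exists_subset_encard_eq hm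
  have := (Set.finite_of_encard_eq_coe hsm).fintype
  have hcard : Fintype.card s = m := by
    rw [Set.encard_eq_coe_toFinset_card, Set.toFinset_card] at hsm
    exact_mod_cast hsm
  let f := (Fintype.equivFinOfCardEq hcard).symm
  exact ⟨fun j => g (f j), fun j => μ (f j),
    h.orthonormal_right.comp (Subtype.val_injective.comp f.injective),
    fun j => ⟨hs (f j).2, h.adjoint_apply_apply_right _⟩⟩

theorem tsum_subtype_enorm_sq_of_eigenvector (h : IsSchmidtDecomposition T g σ μ) {x : H}
    {t ν : ℝ} (ht : 0 ≤ t) (hν : t < ν) (hx : adjoint T (T x) = op ((ν ^ 2 : ℝ) : ℍ) • x) :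
    ∑' k : {k | t < μ k}, ‖inner ℍ (g k) x‖ₑ ^ 2 = ‖x‖ₑ ^ 2 := by
  rw [← h.orthonormal_right.tsum_enorm_sq_of_hasSum
    (h.hasSum_of_eigenvector (ht.trans_lt hν) hx)]
  refine tsum_subtype_eq_of_support_subset (f := fun k => ‖inner ℍ (g k) x‖ₑ ^ 2) fun k hk => ?_
  obtain h0 | rfl := h.qinner_eq_zero_or_eq (ht.trans hν.le) hx k
  · simp [h0] at hk
  · exact hν

theorem natCast_le_encard (h : IsSchmidtDecomposition T g σ μ) {t : ℝ} (ht : 0 ≤ t) {m : ℕ}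
    (hm : HasEigenvectorsAbove T t m) : (m : ℕ∞) ≤ {k | t < μ k}.encard := by
  obtain ⟨e, ν, he, hν⟩ := hm
  suffices (m : ℝ≥0∞) ≤ ({k | t < μ k}.encard : ℝ≥0∞) by exact_mod_cast this
  calc (m : ℝ≥0∞) = ∑' j : Fin m, ‖e j‖ₑ ^ 2 := by simp [he.enorm_eq_one]
    _ = ∑' (j : Fin m) (k : {k | t < μ k}), ‖inner ℍ (g k) (e j)‖ₑ ^ 2 :=
        tsum_congr fun j =>
          (h.tsum_subtype_enorm_sq_of_eigenvector ht (hν j).1 (hν j).2).symm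
    _ = ∑' (k : {k | t < μ k}) (j : Fin m), ‖inner ℍ (e j) (g k)‖ₑ ^ 2 := by
        rw [ENNReal.tsum_comm]
        simp_rw [enorm_qinner_comm (g _)]
    _ ≤ ∑' k : {k | t < μ k}, ‖g k‖ₑ ^ 2 :=
        ENNReal.tsum_le_tsum fun k => he.tsum_enorm_sq_le (g k)
    _ = ({k | t < μ k}.encard : ℝ≥0∞) := by
        simp_rw [h.orthonormal_right.enorm_eq_one, one_pow]
        exact ENNReal.tsum_set_one _

theorem encard_lt_singularValue (h : IsSchmidtDecomposition T g σ μ) {t : ℝ} (ht : 0 ≤ t) :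
    {n | t < singularValue T n}.encard = {k | t < μ k}.encard :=
  ENat.eq_of_forall_natCast_le_iff fun m =>
    (natCast_le_encard_lt_singularValue_iff ht m).trans
      ⟨h.natCast_le_encard ht, h.hasEigenvectorsAbove⟩

theorem tsum_singularValue_rpow (h : IsSchmidtDecomposition T g σ μ) {p : ℝ} (hp : 0 < p) :
    ∑' n, ENNReal.ofReal (singularValue T n) ^ p = ∑' k, ENNReal.ofReal (μ k) ^ p :=
  tsum_ofReal_rpow_eq_of_encard_eq (singularValue_nonneg T) (fun k => (h.pos k).le)
    (fun _ ht => h.encard_lt_singularValue ht) hp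

theorem tsum_enorm_apply_rpow (h : IsSchmidtDecomposition T g σ μ) {p : ℝ} (hp : 0 < p) :
    ∑' k, ‖T (g k)‖ₑ ^ p = ∑' n, ENNReal.ofReal (singularValue T n) ^ p := by
  simp_rw [h.tsum_singularValue_rpow hp, h.enorm_apply_right]

theorem tsum_enorm_qinner_rpow (h : IsSchmidtDecomposition T g σ μ) {p : ℝ} (hp : 0 < p) :
    ∑' k, ‖inner ℍ (σ k) (T (g k))‖ₑ ^ p = ∑' n, ENNReal.ofReal (singularValue T n) ^ p := by
  simp_rw [h.tsum_singularValue_rpow hp, h.qinner_apply, h.enorm_mul_qinner,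
    h.orthonormal_right.qinner_self_eq_one, enorm_one, mul_one]

variable {κ : Type*} {e f : κ → H} {p : ℝ}

theorem tsum_enorm_apply_rpow_le (h : IsSchmidtDecomposition T g σ μ) (he : IsOrthonormal e)
    (hp : 2 ≤ p) :
    ∑' n, ‖T (e n)‖ₑ ^ p ≤ ∑' n, ENNReal.ofReal (singularValue T n) ^ p := by
  rw [h.tsum_singularValue_rpow (two_pos.trans_le hp)]
  simp_rw [← sq_rpow_half _ p, h.enorm_apply_sq]
  refine tsum_rpow_tsum_mul_le (h.orthonormal_right.tsum_enorm_sq_le_one he) (fun k => ?_) _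
    (by linarith)
  simp_rw [enorm_qinner_comm (g k)]
  exact he.tsum_enorm_sq_le_one h.orthonormal_right k

theorem tsum_enorm_qinner_rpow_le (h : IsSchmidtDecomposition T g σ μ) (he : IsOrthonormal e)
    (hf : IsOrthonormal f) (hp : 1 ≤ p) :
    ∑' n, ‖inner ℍ (f n) (T (e n))‖ₑ ^ p ≤ ∑' n, ENNReal.ofReal (singularValue T n) ^ p := by
  rw [h.tsum_singularValue_rpow (one_pos.trans_le hp)]
  refine (ENNReal.tsum_le_tsum fun n => ENNReal.rpow_le_rpow (h.enorm_qinner_apply_le _ _)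
    (by linarith)).trans (tsum_rpow_tsum_mul_le (fun n => ?_) (fun k => ?_) _ hp)
  · exact tsum_mul_le_one (h.orthonormal_left.tsum_enorm_sq_le_one hf n)
      (h.orthonormal_right.tsum_enorm_sq_le_one he n)
  · simp_rw [enorm_qinner_comm (g k), enorm_qinner_comm (σ k)]
    exact tsum_mul_le_one (hf.tsum_enorm_sq_le_one h.orthonormal_left k)
      (he.tsum_enorm_sq_le_one h.orthonormal_right k)

theorem le_tsum_enorm_apply_rpow (h : IsSchmidtDecomposition T g σ μ) (he : IsOrthonormal e)
    (ht : IsTotal e) (hp0 : 0 < p) (hp : p ≤ 2) :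
    ∑' n, ENNReal.ofReal (singularValue T n) ^ p ≤ ∑' n, ‖T (e n)‖ₑ ^ p := by
  rw [h.tsum_singularValue_rpow hp0]
  simp_rw [← sq_rpow_half _ p, h.enorm_apply_sq]
  refine tsum_rpow_le_tsum_rpow_tsum_mul (h.orthonormal_right.tsum_enorm_sq_le_one he)
    (fun k => ?_) _ (half_pos hp0) (by linarith)
  simp_rw [enorm_qinner_comm (g k)]
  rw [he.tsum_enorm_sq ht, h.orthonormal_right.enorm_eq_one, one_pow]

end IsSchmidtDecomposition

end SingularValues

section SchattenClass

theorem mem_schattenClass_iff [CompleteSpace H] {J T : H →L[ℍᵐᵒᵖ] H} (hT : IsCompactOperator T)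
    (hTJ : Commute T J) {p : ℝ} (hp : 0 < p) :
    T ∈ schattenClass J p ↔ ∑' n, ENNReal.ofReal (singularValue T n) ^ p < ∞ := by
  have hmem : T ∈ schattenClass J p ↔ Summable fun n => singularValue T n ^ p :=
    ⟨fun h => h.2.2, fun h => ⟨hT, hTJ, h⟩⟩
  simp_rw [hmem, ENNReal.ofReal_rpow_of_nonneg (singularValue_nonneg T _) hp.le, lt_top_iff_ne_top]
  refine ⟨fun h => h.tsum_ofReal_ne_top, fun h => (ENNReal.summable_toReal h).congr fun n => ?_⟩
  exact ENNReal.toReal_ofReal (Real.rpow_nonneg (singularValue_nonneg T n) p)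

theorem schattenNorm_rpow [CompleteSpace H] (T : H →L[ℍᵐᵒᵖ] H) {p : ℝ} (hp : p ≠ 0) :
    schattenNorm p T ^ p = ∑' n, ENNReal.ofReal (singularValue T n) ^ p := by
  rw [schattenNorm, one_div, ENNReal.rpow_inv_rpow hp]

variable [CompleteSpace H] {J : H →L[ℍᵐᵒᵖ] H} (hJ : IsAntiSelfAdjointUnitary J) {i : ℍ}
  (hi : i.re = 0) (hn : ‖i‖ = 1) {T : H →L[ℍᵐᵒᵖ] H} (hT : IsCompactOperator T)
  (hTJ : Commute T J)

include hJ hi hn hT hTJ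

theorem exists_schmidtDecomposition_HPlus : ∃ (I : Set ℕ) (g σ : I → H) (μ : I → ℝ),
    IsSchmidtDecomposition T g σ μ ∧ IsOrthonormalIn J i g ∧ IsOrthonormalIn J i σ := by
  obtain ⟨S, hS, ht, hSA⟩ := exists_eigenbasis hJ hi hn (A := adjoint T * T)
    (hT.clm_comp (adjoint T)) (adjoint_adjoint_mul_self T) ((commute_adjoint hJ hTJ).mul_left hTJ)
  obtain ⟨I, f, hf, h⟩ := exists_isSchmidtDecomposition hS.1 ht hT fun y z hyz => by
    obtain ⟨r, hr⟩ := hSA z z.2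
    rw [← qadjoint_inner_right, ← mul_apply_eq_comp, hr, qinner_real_smul_right, hS.1.2 y z hyz,
      mul_zero]
  exact ⟨I, _, _, _, h, hS.comp hf, h.orthonormal_left, fun n =>
    (hPlusSubmodule J i).smul_mem _ (apply_mem_HPlus hTJ (hS.2 (f n)))⟩

theorem exists_schmidtDecomposition_of_selfAdjoint (hs : adjoint T = T) :
    ∃ (I : Set ℕ) (g σ : I → H) (μ : I → ℝ), IsSchmidtDecomposition T g σ μ ∧
      IsOrthonormalIn J i g ∧ ∀ k, ‖inner ℍ (g k) (T (g k))‖ₑ = ‖T (g k)‖ₑ := by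
  obtain ⟨S, hS, ht, hSA⟩ := exists_eigenbasis hJ hi hn hT hs hTJ
  obtain ⟨I, f, hf, h⟩ := exists_isSchmidtDecomposition hS.1 ht hT fun y z hyz => by
    obtain ⟨r, hr⟩ := hSA y y.2
    obtain ⟨r', hr'⟩ := hSA z z.2
    rw [hr, hr', qinner_real_smul_left, qinner_real_smul_right, hS.1.2 y z hyz, mul_zero, mul_zero]
  refine ⟨I, _, _, _, h, hS.comp hf, fun n => ?_⟩
  obtain ⟨r, hr⟩ := hSA (f n) (f n).2
  rw [hr, qinner_real_smul_right, hS.1.qinner_self_eq_one, mul_one, enorm_smul,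
    hS.1.enorm_eq_one, mul_one, ← ofReal_norm, ← ofReal_norm, Quaternion.norm_coe]

theorem exists_tsum_enorm_apply_rpow_eq {p : ℝ} (hp : 0 < p) :
    ∃ (I : Set ℕ) (e : I → H), IsOrthonormalIn J i e ∧
      ∑' n, ‖T (e n)‖ₑ ^ p = ∑' n, ENNReal.ofReal (singularValue T n) ^ p :=
  let ⟨I, g, _, _, h, hg, _⟩ := exists_schmidtDecomposition_HPlus hJ hi hn hT hTJ
  ⟨I, g, hg, h.tsum_enorm_apply_rpow hp⟩

theorem exists_tsum_enorm_qinner_rpow_eq {p : ℝ} (hp : 0 < p) :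
    ∃ (I : Set ℕ) (e σ : I → H), IsOrthonormalIn J i e ∧ IsOrthonormalIn J i σ ∧
      ∑' n, ‖inner ℍ (σ n) (T (e n))‖ₑ ^ p = ∑' n, ENNReal.ofReal (singularValue T n) ^ p :=
  let ⟨I, g, σ, _, h, hg, hσ⟩ := exists_schmidtDecomposition_HPlus hJ hi hn hT hTJ
  ⟨I, g, σ, hg, hσ, h.tsum_enorm_qinner_rpow hp⟩

theorem exists_tsum_enorm_qinner_self_rpow_eq (hs : adjoint T = T) {p : ℝ} (hp : 0 < p) :
    ∃ (I : Set ℕ) (e : I → H), IsOrthonormalIn J i e ∧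
      ∑' n, ‖inner ℍ (e n) (T (e n))‖ₑ ^ p = ∑' n, ENNReal.ofReal (singularValue T n) ^ p := by
  obtain ⟨I, g, _, _, h, hg, hgT⟩ :=
    exists_schmidtDecomposition_of_selfAdjoint hJ hi hn hT hTJ hs
  exact ⟨I, g, hg, by simp_rw [hgT, h.tsum_enorm_apply_rpow hp]⟩

variable {κ : Type*} {e f : κ → H} {p : ℝ}

theorem tsum_enorm_apply_rpow_le (he : IsOrthonormal e) (hp : 2 ≤ p) :
    ∑' n, ‖T (e n)‖ₑ ^ p ≤ ∑' n, ENNReal.ofReal (singularValue T n) ^ p :=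
  let ⟨_, _, _, _, h, _⟩ := exists_schmidtDecomposition_HPlus hJ hi hn hT hTJ
  h.tsum_enorm_apply_rpow_le he hp

theorem tsum_enorm_qinner_rpow_le (he : IsOrthonormal e) (hf : IsOrthonormal f) (hp : 1 ≤ p) :
    ∑' n, ‖inner ℍ (f n) (T (e n))‖ₑ ^ p ≤ ∑' n, ENNReal.ofReal (singularValue T n) ^ p :=
  let ⟨_, _, _, _, h, _⟩ := exists_schmidtDecomposition_HPlus hJ hi hn hT hTJ
  h.tsum_enorm_qinner_rpow_le he hf hp

end SchattenClass

section CartesianDecomposition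

variable [CompleteSpace H] {J : H →L[ℍᵐᵒᵖ] H} {i : ℍ} {T : H →L[ℍᵐᵒᵖ] H}

theorem adjoint_add_adjoint_self (T : H →L[ℍᵐᵒᵖ] H) :
    adjoint (T + adjoint T) = T + adjoint T := by
  rw [adjoint_add, adjoint_adjoint, add_comm]

theorem commute_mul_sub_adjoint (hJ : IsAntiSelfAdjointUnitary J) (hTJ : Commute T J) :
    Commute (J * (T - adjoint T)) J :=
  (Commute.refl J).mul_left (hTJ.sub_left (commute_adjoint hJ hTJ))

theorem adjoint_mul_sub_adjoint (hJ : IsAntiSelfAdjointUnitary J) (hTJ : Commute T J) :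
    adjoint (J * (T - adjoint T)) = J * (T - adjoint T) := by
  rw [adjoint_mul, adjoint_sub, adjoint_adjoint, hJ.1,
    ← (hTJ.sub_left (commute_adjoint hJ hTJ)).eq]
  ext x
  simp only [mul_apply_eq_comp, sub_apply, neg_apply, map_neg]
  abel

theorem enorm_qinner_apply_of_mem_HPlus (hJ : IsAntiSelfAdjointUnitary J) (hn : ‖i‖ = 1) {x : H}
    (hx : x ∈ HPlus J i) (y : H) : ‖inner ℍ x (J y)‖ₑ = ‖inner ℍ x y‖ₑ := by
  rw [qinner_apply_right_of_mem_HPlus hJ hx, enorm_neg, enorm_mul, ← ofReal_norm (star i),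
    Quaternion.norm_star, hn, ENNReal.ofReal_one, one_mul]

theorem enorm_qinner_adjoint_self (T : H →L[ℍᵐᵒᵖ] H) (x : H) :
    ‖inner ℍ x (adjoint T x)‖ₑ = ‖inner ℍ x (T x)‖ₑ := by
  rw [qadjoint_inner_right, enorm_qinner_comm]

theorem enorm_qinner_add_adjoint_le (T : H →L[ℍᵐᵒᵖ] H) (x : H) :
    ‖inner ℍ x ((T + adjoint T) x)‖ₑ ≤ 2 * ‖inner ℍ x (T x)‖ₑ := by
  rw [add_apply, qinner_add_right]
  exact (enorm_add_le _ _).trans_eq (by rw [enorm_qinner_adjoint_self, two_mul])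

theorem enorm_qinner_mul_sub_adjoint_le (hJ : IsAntiSelfAdjointUnitary J) (hn : ‖i‖ = 1) {x : H}
    (hx : x ∈ HPlus J i) :
    ‖inner ℍ x ((J * (T - adjoint T)) x)‖ₑ ≤ 2 * ‖inner ℍ x (T x)‖ₑ := by
  rw [mul_apply_eq_comp, enorm_qinner_apply_of_mem_HPlus hJ hn hx, sub_apply, qinner_sub_right]
  exact enorm_sub_le.trans_eq (by rw [enorm_qinner_adjoint_self, two_mul])

theorem enorm_qinner_le_add_adjoint_add_mul_sub_adjoint (hJ : IsAntiSelfAdjointUnitary J)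
    (hn : ‖i‖ = 1) {x : H} (hx : x ∈ HPlus J i) (y : H) :
    ‖inner ℍ x (T y)‖ₑ ≤
      ‖inner ℍ x ((T + adjoint T) y)‖ₑ + ‖inner ℍ x ((J * (T - adjoint T)) y)‖ₑ := by
  rw [mul_apply_eq_comp, enorm_qinner_apply_of_mem_HPlus hJ hn hx, add_apply, sub_apply,
    qinner_add_right, qinner_sub_right]
  exact enorm_le_enorm_add_add_enorm_sub _ _

theorem tsum_singularValue_rpow_le_of_commute (hJ : IsAntiSelfAdjointUnitary J) (hi : i.re = 0)
    (hn : ‖i‖ = 1) (hT : IsCompactOperator T) (hTJ : Commute T J) {p : ℝ} (hp : 1 ≤ p) :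
    ∑' n, ENNReal.ofReal (singularValue T n) ^ p ≤
      2 ^ (p - 1) * (∑' n, ENNReal.ofReal (singularValue (T + adjoint T) n) ^ p +
        ∑' n, ENNReal.ofReal (singularValue (J * (T - adjoint T)) n) ^ p) := by
  have hp0 : 0 < p := one_pos.trans_le hp
  have hT' := isCompactOperator_adjoint hT
  obtain ⟨I, e, σ, he, hσ, heq⟩ := exists_tsum_enorm_qinner_rpow_eq hJ hi hn hT hTJ hp0
  calc ∑' n, ENNReal.ofReal (singularValue T n) ^ p
      ≤ ∑' n, 2 ^ (p - 1) * (‖inner ℍ (σ n) ((T + adjoint T) (e n))‖ₑ ^ p +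
          ‖inner ℍ (σ n) ((J * (T - adjoint T)) (e n))‖ₑ ^ p) := by
        rw [← heq]
        exact ENNReal.tsum_le_tsum fun n => (ENNReal.rpow_le_rpow
          (enorm_qinner_le_add_adjoint_add_mul_sub_adjoint hJ hn (hσ.2 n) (e n)) hp0.le).trans
          (ENNReal.rpow_add_le_mul_rpow_add_rpow _ _ hp)
    _ ≤ _ := by
        rw [ENNReal.tsum_mul_left, ENNReal.tsum_add]
        gcongr
        · exact tsum_enorm_qinner_rpow_le hJ hi hn (hT.add hT')
            (hTJ.add_left (commute_adjoint hJ hTJ)) he.1 hσ.1 hp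
        · exact tsum_enorm_qinner_rpow_le hJ hi hn ((hT.sub hT').clm_comp J)
            (commute_mul_sub_adjoint hJ hTJ) he.1 hσ.1 hp

theorem tsum_singularValue_rpow_lt_top_of_selfAdjoint (hJ : IsAntiSelfAdjointUnitary J)
    (hi : i.re = 0) (hn : ‖i‖ = 1) {A : H →L[ℍᵐᵒᵖ] H} (hA : IsCompactOperator A)
    (hAJ : Commute A J) (hs : adjoint A = A)
    (hAT : ∀ x ∈ HPlus J i, ‖inner ℍ x (A x)‖ₑ ≤ 2 * ‖inner ℍ x (T x)‖ₑ) {p : ℝ} (hp : 0 < p)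
    (hd : ∀ (I : Set ℕ) (e : I → H), IsOrthonormalIn J i e →
      ∑' n, ‖inner ℍ (e n) (T (e n))‖ₑ ^ p < ∞) :
    ∑' n, ENNReal.ofReal (singularValue A n) ^ p < ∞ := by
  obtain ⟨I, e, he, heq⟩ := exists_tsum_enorm_qinner_self_rpow_eq hJ hi hn hA hAJ hs hp
  calc ∑' n, ENNReal.ofReal (singularValue A n) ^ p
      ≤ ∑' n, (2 * ‖inner ℍ (e n) (T (e n))‖ₑ) ^ p := by
        rw [← heq]
        exact ENNReal.tsum_le_tsum fun n => ENNReal.rpow_le_rpow (hAT _ (he.2 n)) hp.le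
    _ = 2 ^ p * ∑' n, ‖inner ℍ (e n) (T (e n))‖ₑ ^ p := by
        simp_rw [ENNReal.mul_rpow_of_nonneg _ _ hp.le, ENNReal.tsum_mul_left]
    _ < ∞ := ENNReal.mul_lt_top (ENNReal.rpow_lt_top_of_nonneg hp.le ENNReal.ofNat_ne_top)
        (hd I e he)

theorem tsum_singularValue_rpow_lt_top_of_diagonal (hJ : IsAntiSelfAdjointUnitary J)
    (hi : i.re = 0) (hn : ‖i‖ = 1) (hT : IsCompactOperator T) (hTJ : Commute T J) {p : ℝ}
    (hp : 1 ≤ p) (hd : ∀ (I : Set ℕ) (e : I → H), IsOrthonormalIn J i e →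
      ∑' n, ‖inner ℍ (e n) (T (e n))‖ₑ ^ p < ∞) :
    ∑' n, ENNReal.ofReal (singularValue T n) ^ p < ∞ := by
  have hp0 : 0 < p := one_pos.trans_le hp
  have hT' := isCompactOperator_adjoint hT
  refine (tsum_singularValue_rpow_le_of_commute hJ hi hn hT hTJ hp).trans_lt
    (ENNReal.mul_lt_top (ENNReal.rpow_lt_top_of_nonneg (sub_nonneg.2 hp) ENNReal.ofNat_ne_top)
      (ENNReal.add_lt_top.2 ⟨?_, ?_⟩))
  · exact tsum_singularValue_rpow_lt_top_of_selfAdjoint hJ hi hn (hT.add hT')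
      (hTJ.add_left (commute_adjoint hJ hTJ)) (adjoint_add_adjoint_self T)
      (fun x _ => enorm_qinner_add_adjoint_le T x) hp0 hd
  · exact tsum_singularValue_rpow_lt_top_of_selfAdjoint hJ hi hn ((hT.sub hT').clm_comp J)
      (commute_mul_sub_adjoint hJ hTJ) (adjoint_mul_sub_adjoint hJ hTJ)
      (fun x hx => enorm_qinner_mul_sub_adjoint_le hJ hn hx) hp0 hd

end CartesianDecomposition

section Characterizations

variable [CompleteSpace H] {J : H →L[ℍᵐᵒᵖ] H} (hJ : IsAntiSelfAdjointUnitary J) {i : ℍ}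
  (hi : i.re = 0) (hn : ‖i‖ = 1) {T : H →L[ℍᵐᵒᵖ] H} (hT : IsCompactOperator T)
  (hTJ : Commute T J)

include hJ hi hn hT hTJ

variable {p : ℝ}

theorem mem_schattenClass_iff_forall_apply (hp : 2 ≤ p) :
    T ∈ schattenClass J p ↔
      ∀ (I : Set ℕ) (e : I → H), IsOrthonormalIn J i e → ∑' n, ‖T (e n)‖ₑ ^ p < ∞ := by
  have hp0 : 0 < p := two_pos.trans_le hp
  rw [mem_schattenClass_iff hT hTJ hp0]
  refine ⟨fun h I e he =>
    (tsum_enorm_apply_rpow_le hJ hi hn hT hTJ he.1 hp).trans_lt h, fun h => ?_⟩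
  obtain ⟨I, e, he, heq⟩ := exists_tsum_enorm_apply_rpow_eq hJ hi hn hT hTJ hp0
  exact heq ▸ h I e he

theorem schattenNorm_eq_iSup_apply (hp : 2 ≤ p) :
    schattenNorm p T = ⨆ (I : Set ℕ) (e : I → H) (_ : IsOrthonormalIn J i e),
      (∑' n, ‖T (e n)‖ₑ ^ p) ^ (1 / p) := by
  have hp0 : 0 < p := two_pos.trans_le hp
  refine le_antisymm ?_ (iSup₂_le fun I e => iSup_le fun he => ENNReal.rpow_le_rpow
    (tsum_enorm_apply_rpow_le hJ hi hn hT hTJ he.1 hp) (one_div_pos.2 hp0).le)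
  obtain ⟨I, e, he, heq⟩ := exists_tsum_enorm_apply_rpow_eq hJ hi hn hT hTJ hp0
  rw [schattenNorm, ← heq]
  exact le_iSup₂_of_le I e (le_iSup_of_le he le_rfl)

theorem mem_schattenClass_iff_forall_diagonal (hp : 1 ≤ p) :
    T ∈ schattenClass J p ↔ ∀ (I : Set ℕ) (e : I → H), IsOrthonormalIn J i e →
      ∑' n, ‖inner ℍ (e n) (T (e n))‖ₑ ^ p < ∞ := by
  rw [mem_schattenClass_iff hT hTJ (one_pos.trans_le hp)]
  exact ⟨fun h I e he => (tsum_enorm_qinner_rpow_le hJ hi hn hT hTJ he.1 he.1 hp).trans_lt h,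
    tsum_singularValue_rpow_lt_top_of_diagonal hJ hi hn hT hTJ hp⟩

theorem schattenNorm_eq_iSup_diagonal (hs : adjoint T = T) (hp : 1 ≤ p) :
    schattenNorm p T = ⨆ (I : Set ℕ) (e : I → H) (_ : IsOrthonormalIn J i e),
      (∑' n, ‖inner ℍ (e n) (T (e n))‖ₑ ^ p) ^ (1 / p) := by
  have hp0 : 0 < p := one_pos.trans_le hp
  refine le_antisymm ?_ (iSup₂_le fun I e => iSup_le fun he => ENNReal.rpow_le_rpow
    (tsum_enorm_qinner_rpow_le hJ hi hn hT hTJ he.1 he.1 hp) (one_div_pos.2 hp0).le)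
  obtain ⟨I, e, he, heq⟩ := exists_tsum_enorm_qinner_self_rpow_eq hJ hi hn hT hTJ hs hp0
  rw [schattenNorm, ← heq]
  exact le_iSup₂_of_le I e (le_iSup_of_le he le_rfl)

theorem mem_schattenClass_iff_forall_qinner (hp : 1 ≤ p) :
    T ∈ schattenClass J p ↔ ∀ (I : Set ℕ) (e σ : I → H), IsOrthonormalIn J i e →
      IsOrthonormalIn J i σ → ∑' n, ‖inner ℍ (σ n) (T (e n))‖ₑ ^ p < ∞ := by
  have hp0 : 0 < p := one_pos.trans_le hp
  rw [mem_schattenClass_iff hT hTJ hp0]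
  refine ⟨fun h I e σ he hσ =>
    (tsum_enorm_qinner_rpow_le hJ hi hn hT hTJ he.1 hσ.1 hp).trans_lt h, fun h => ?_⟩
  obtain ⟨I, e, σ, he, hσ, heq⟩ := exists_tsum_enorm_qinner_rpow_eq hJ hi hn hT hTJ hp0
  exact heq ▸ h I e σ he hσ

theorem schattenNorm_eq_iSup_qinner (hp : 1 ≤ p) :
    schattenNorm p T = ⨆ (I : Set ℕ) (e : I → H) (σ : I → H) (_ : IsOrthonormalIn J i e)
      (_ : IsOrthonormalIn J i σ), (∑' n, ‖inner ℍ (σ n) (T (e n))‖ₑ ^ p) ^ (1 / p) := by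
  have hp0 : 0 < p := one_pos.trans_le hp
  refine le_antisymm ?_ (iSup₂_le fun I e => iSup₂_le fun σ he => iSup_le fun hσ =>
    ENNReal.rpow_le_rpow (tsum_enorm_qinner_rpow_le hJ hi hn hT hTJ he.1 hσ.1 hp)
      (one_div_pos.2 hp0).le)
  obtain ⟨I, e, σ, he, hσ, heq⟩ := exists_tsum_enorm_qinner_rpow_eq hJ hi hn hT hTJ hp0
  rw [schattenNorm, ← heq]
  exact le_iSup₂_of_le I e (le_iSup₂_of_le σ he (le_iSup_of_le hσ le_rfl))

theorem schattenNorm_rpow_le_tsum {ι : Type*} {e : ι → H} (he : IsOrthonormalBasisOf J i e)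
    (hp0 : 0 < p) (hp : p ≤ 2) :
    schattenNorm p T ^ p ≤ ∑' n, ∑' k, ‖inner ℍ (e k) (T (e n))‖ₑ ^ p := by
  obtain ⟨_, _, _, _, h, _⟩ := exists_schmidtDecomposition_HPlus hJ hi hn hT hTJ
  have ht := isTotal_of_HPlus hJ hi hn he
  rw [schattenNorm_rpow T hp0.ne']
  exact (h.le_tsum_enorm_apply_rpow he.1.1 ht hp0 hp).trans
    (ENNReal.tsum_le_tsum fun n => he.1.1.enorm_rpow_le_tsum ht (T (e n)) hp0 hp)

end Characterizations

end QuatSchatten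

theorem mainTheorem10_general {H : Type*} [NormedAddCommGroup H]
    [QuaternionicInnerProductSpace H] [CompleteSpace H] {J : H →L[ℍᵐᵒᵖ] H}
    (hJ : IsAntiSelfAdjointUnitary J) {i : ℍ} (hi : i.re = 0) (hn : ‖i‖ = 1)
    {T : H →L[ℍᵐᵒᵖ] H} (hT : IsCompactOperator T) (hTJ : Commute T J) :
    (∀ p : ℝ, 2 ≤ p →
      (T ∈ schattenClass J p ↔
        ∀ (I : Set ℕ) (e : I → H), IsOrthonormalIn J i e → ∑' n, ‖T (e n)‖ₑ ^ p < ∞) ∧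
      schattenNorm p T =
        ⨆ (I : Set ℕ) (e : I → H) (_ : IsOrthonormalIn J i e),
          (∑' n, ‖T (e n)‖ₑ ^ p) ^ (1 / p)) ∧
    (∀ p : ℝ, 1 ≤ p →
      (T ∈ schattenClass J p ↔
        ∀ (I : Set ℕ) (e : I → H), IsOrthonormalIn J i e →
          ∑' n, ‖inner ℍ (e n) (T (e n))‖ₑ ^ p < ∞) ∧
      (adjoint T = T →
        schattenNorm p T =
          ⨆ (I : Set ℕ) (e : I → H) (_ : IsOrthonormalIn J i e),
            (∑' n, ‖inner ℍ (e n) (T (e n))‖ₑ ^ p) ^ (1 / p))) ∧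
    (∀ p : ℝ, 1 ≤ p →
      (T ∈ schattenClass J p ↔
        ∀ (I : Set ℕ) (e σ : I → H), IsOrthonormalIn J i e → IsOrthonormalIn J i σ →
          ∑' n, ‖inner ℍ (σ n) (T (e n))‖ₑ ^ p < ∞) ∧
      schattenNorm p T =
        ⨆ (I : Set ℕ) (e : I → H) (σ : I → H) (_ : IsOrthonormalIn J i e)
          (_ : IsOrthonormalIn J i σ),
          (∑' n, ‖inner ℍ (σ n) (T (e n))‖ₑ ^ p) ^ (1 / p)) ∧
    (∀ p : ℝ, 0 < p → p ≤ 2 →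
      ∀ (ι : Type*) (e : ι → H), IsOrthonormalBasisOf J i e →
        schattenNorm p T ^ p ≤ ∑' n, ∑' k, ‖inner ℍ (e k) (T (e n))‖ₑ ^ p) :=
  ⟨fun _ hp => ⟨mem_schattenClass_iff_forall_apply hJ hi hn hT hTJ hp,
      schattenNorm_eq_iSup_apply hJ hi hn hT hTJ hp⟩,
    fun _ hp => ⟨mem_schattenClass_iff_forall_diagonal hJ hi hn hT hTJ hp,
      fun hs => schattenNorm_eq_iSup_diagonal hJ hi hn hT hTJ hs hp⟩,
    fun _ hp => ⟨mem_schattenClass_iff_forall_qinner hJ hi hn hT hTJ hp,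
      schattenNorm_eq_iSup_qinner hJ hi hn hT hTJ hp⟩,
    fun _ hp0 hp _ _ he => schattenNorm_rpow_le_tsum hJ hi hn hT hTJ he hp0 hp⟩

theorem mainTheorem10 {H : Type*} [NormedAddCommGroup H] [QuaternionicInnerProductSpace H]
    [CompleteSpace H] [TopologicalSpace.SeparableSpace H]
    (J : H →L[ℍᵐᵒᵖ] H) (hJ : IsAntiSelfAdjointUnitary J) (i : ℍ) (hi_re : i.re = 0) (hi_norm : ‖i‖ = 1)
    (T : H →L[ℍᵐᵒᵖ] H) (hT : IsCompactOperator T) (hTJ : T * J = J * T) :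
    -- the sums of `‖T e_n‖ ^ p`, for `p ≥ 2`
    (∀ p : ℝ, 2 ≤ p →
      (T ∈ schattenClass J p ↔
        ∀ (I : Set ℕ) (e : I → H), IsOrthonormalIn J i e → ∑' n, ‖T (e n)‖ₑ ^ p < ∞) ∧
      schattenNorm p T =
        ⨆ (I : Set ℕ) (e : I → H) (_ : IsOrthonormalIn J i e),
          (∑' n, ‖T (e n)‖ₑ ^ p) ^ (1 / p)) ∧
    -- the diagonal sums, for `p ≥ 1`
    (∀ p : ℝ, 1 ≤ p →
      (T ∈ schattenClass J p ↔
        ∀ (I : Set ℕ) (e : I → H), IsOrthonormalIn J i e →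
          ∑' n, ‖inner ℍ (e n) (T (e n))‖ₑ ^ p < ∞) ∧
      (adjoint T = T →
        schattenNorm p T =
          ⨆ (I : Set ℕ) (e : I → H) (_ : IsOrthonormalIn J i e),
            (∑' n, ‖inner ℍ (e n) (T (e n))‖ₑ ^ p) ^ (1 / p))) ∧
    -- the sums over pairs of orthonormal sets, for `p ≥ 1`
    (∀ p : ℝ, 1 ≤ p →
      (T ∈ schattenClass J p ↔
        ∀ (I : Set ℕ) (e σ : I → H), IsOrthonormalIn J i e → IsOrthonormalIn J i σ →
          ∑' n, ‖inner ℍ (σ n) (T (e n))‖ₑ ^ p < ∞) ∧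
      (IsPositive T →
        schattenNorm p T =
          ⨆ (I : Set ℕ) (e : I → H) (σ : I → H) (_ : IsOrthonormalIn J i e)
            (_ : IsOrthonormalIn J i σ),
            (∑' n, ‖inner ℍ (σ n) (T (e n))‖ₑ ^ p) ^ (1 / p))) ∧
    -- the bound by the matrix entries, for `0 < p ≤ 2`
    (∀ p : ℝ, 0 < p → p ≤ 2 →
      ∀ (I : Set ℕ) (e : I → H), IsOrthonormalBasisOf J i e →
        schattenNorm p T ^ p ≤ ∑' n, ∑' k, ‖inner ℍ (e k) (T (e n))‖ₑ ^ p) := by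
  have h := mainTheorem10_general hJ hi_re hi_norm hT hTJ
  exact ⟨h.1, h.2.1, fun p hp => ⟨(h.2.2.1 p hp).1, fun _ => (h.2.2.1 p hp).2⟩,
    fun p hp0 hp _ => h.2.2.2 p hp0 hp _⟩
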